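/- Let the computational model be the deterministic Turing machine with a read-only input tape, read-write work tapes and a write-only output tape, where only the cells visited on the work tapes count as space. All languages are over finite alphabets. For functions $t,s$ of the input length $n$, let $\mathrm{TISP}(t(n),s(n))$ be the class of languages decided by such a machine that runs simultaneously in $O(t(n))$ time and $O(s(n))$ space; let $\mathrm{TISP}(n^{O(1)},n^{\varepsilon})=\bigcup_{k\in\mathbb{N}}\mathrm{TISP}(n^{k},n^{\varepsilon})$ and $$\text{near-SC}=\bigcap_{\varepsilon>0}\mathrm{TISP}(n^{O(1)},n^{\varepsilon}).$$ Write $A\le_l B$ if there is a function $f$ from words over the alphabet of $A$ to words over the alphabet of $B$, computable by such a machine that always halts and uses $O(\log n)$ space, such that for every word $x$, $x\in A$ if and only if $f(x)\in B$. Theorem. The class near-SC is closed under log-space many-one reductions: if $A\le_l B$ and $B\in\text{near-SC}$, then $A\in\text{near-SC}$. -/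

import Mathlib

/-- The contents of a cell of the read-only input tape: a letter of the input word,
or one of the two end markers that surround it. -/
inductive InputSymbol (α : Type) where
  | leftEnd : InputSymbol α
  | letter : α → InputSymbol α
  | rightEnd : InputSymbol α

/-- The input tape holding the word `x`: the left end marker in cell `0`, the letters of `x` in the
cells `1, …, |x|`, the right end marker in cell `|x| + 1`. -/
def inputAt {α : Type} (x : List α) : ℕ → InputSymbol α
  | 0 => InputSymbol.leftEnd
  | i + 1 =>
    match x[i]? with
    | some a => InputSymbol.letter a
    | none => InputSymbol.rightEnd

/-- Head movements. -/
inductive HeadMove where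
  | left : HeadMove
  | stay : HeadMove
  | right : HeadMove

/-- The new position of a head on a tape with cells `0, 1, 2, …`; at cell `0` a move to the left
has no effect. -/
def HeadMove.apply : HeadMove → ℕ → ℕ
  | HeadMove.left, p => p - 1
  | HeadMove.stay, p => p
  | HeadMove.right, p => p + 1

/-- What a machine does in one step: enter a new state, move the input head, write a symbol on each
work tape, move the head of each work tape, and append at most one symbol to the output tape. -/
structure TMAction (β Q K Γ : Type) where
  state : Q
  inMove : HeadMove
  write : K → Γ
  move : K → HeadMove
  emit : Option β

/-- A deterministic Turing machine with a two-way read-only input tape over the alphabet `α`,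
finitely many read-write work tapes, and a one-way write-only output tape over the alphabet `β`. -/
structure OfflineTM (α β : Type) where
  /-- states -/
  Q : Type
  /-- indices of the work tapes -/
  K : Type
  /-- work alphabet -/
  Γ : Type
  [finQ : Finite Q]
  [finK : Finite K]
  [finΓ : Finite Γ]
  /-- initial state -/
  start : Q
  /-- blank symbol of the work tapes -/
  blank : Γ
  /-- accepting states -/
  accept : Set Q
  /-- The transition function: it sees the state, the scanned input symbol and the scanned symbols
  of the work tapes; `none` means that the machine halts. -/
  δ : Q → InputSymbol α → (K → Γ) → Option (TMAction β Q K Γ)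

namespace OfflineTM

variable {α β : Type}

/-- Configurations of a machine. -/
structure Cfg (M : OfflineTM α β) where
  state : M.Q
  /-- position of the input head -/
  inHead : ℕ
  /-- contents of the work tapes -/
  tape : M.K → ℕ → M.Γ
  /-- positions of the heads on the work tapes -/
  head : M.K → ℕ
  /-- the word written on the output tape so far -/
  out : List β

/-- The initial configuration. -/
def init (M : OfflineTM α β) : M.Cfg where
  state := M.start
  inHead := 0
  tape := fun _ _ => M.blank
  head := fun _ => 0
  out := []

/-- One step on the input `x`; the value is `none` if the machine has halted. The input head never
leaves the part of the input tape delimited by the end markers. -/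
def step (M : OfflineTM α β) (x : List α) (c : M.Cfg) : Option M.Cfg :=
  (M.δ c.state (inputAt x c.inHead) (fun k => c.tape k (c.head k))).map fun a =>
    { state := a.state
      inHead := min (a.inMove.apply c.inHead) (x.length + 1)
      tape := fun k => Function.update (c.tape k) (c.head k) (a.write k)
      head := fun k => (a.move k).apply (c.head k)
      out := c.out ++ a.emit.toList }

/-- The configuration after `t` steps on the input `x`. Once the machine has halted, the
configuration does not change any more. -/
def config (M : OfflineTM α β) (x : List α) : ℕ → M.Cfg
  | 0 => M.init
  | t + 1 => (M.step x (M.config x t)).getD (M.config x t)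

/-- On the input `x` the machine halts after at most `t` steps. -/
def HaltsWithin (M : OfflineTM α β) (x : List α) (t : ℕ) : Prop :=
  M.step x (M.config x t) = none

/-- On the input `x` the machine visits at most the first `s` cells of each work tape. (The number
of work tapes is fixed with the machine, so the total number of work cells visited is the same up
to a constant factor. Input tape and output tape are not counted.) -/
def UsesSpace (M : OfflineTM α β) (x : List α) (s : ℕ) : Prop :=
  ∀ t k, (M.config x t).head k < s

end OfflineTM

open Asymptotics Filter in
/-- `TISP α t s`: the languages over `α` that are decided by a deterministic Turing machine which
runs in time `O(t(n))` and, simultaneously, in space `O(s(n))`. A machine that decides a language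
has no output (its output alphabet is empty); it answers through its accepting states. -/
def TISP (α : Type) (t s : ℕ → ℝ) : Set (Language α) :=
  {L | ∃ (M : OfflineTM α Empty) (T S : ℕ → ℕ),
    (fun n => (T n : ℝ)) =O[atTop] t ∧
    (fun n => (S n : ℝ)) =O[atTop] s ∧
    ∀ x : List α,
      M.HaltsWithin x (T x.length) ∧
      M.UsesSpace x (S x.length) ∧
      ((M.config x (T x.length)).state ∈ M.accept ↔ x ∈ L)}

/-- `TISP(n^{O(1)}, n^ε)`. -/
def NearSCEps (α : Type) (ε : ℝ) : Set (Language α) :=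
  ⋃ k : ℕ, TISP α (fun n => (n : ℝ) ^ k) (fun n => (n : ℝ) ^ ε)

/-- The class near-SC of languages over `α`. -/
def NearSC (α : Type) : Set (Language α) :=
  ⋂ (ε : ℝ) (_ : 0 < ε), NearSCEps α ε

open Asymptotics Filter in
/-- `f` is computed by a deterministic Turing machine that halts on every input and works in space
`O(log n)`. -/
def LogSpaceComputable {α β : Type} (f : List α → List β) : Prop :=
  ∃ (M : OfflineTM α β) (S : ℕ → ℕ),
    (fun n => (S n : ℝ)) =O[atTop] (fun n : ℕ => Real.logb 2 n) ∧
    ∀ x : List α,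
      M.UsesSpace x (S x.length) ∧
      ∃ t, M.HaltsWithin x t ∧ (M.config x t).out = f x

/-- Log-space many-one reducibility `A ≤_l B`. -/
def LogSpaceReducible {α β : Type} (A : Language α) (B : Language β) : Prop :=
  ∃ f : List α → List β, LogSpaceComputable f ∧ ∀ x, x ∈ A ↔ f x ∈ B

/-! Let `M` compute the reduction `f` in logarithmic space and let `N` decide `B`. The word `f x`
may be too long to store, so `compose M N` simulates `N` on it while keeping only the position `i`
of the virtual input head of `N`. Whenever the symbol at position `i` is needed, `M` is restarted
from scratch and its letters are discarded but counted in a second counter `j`; the letter that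
makes `j` equal to `i` is the one wanted. If `i = 0` the symbol is the left end marker, and if `M`
halts too early it is the right one.

Before it halts, a halting machine never repeats a configuration, so `M` halts within a polynomial
time `T n = O(n ^ c)` (`haltsWithin_of_usesSpace`), which also bounds the length of `f x`. Hence the
counters have `O(log n)` digits, fetching one symbol takes polynomial time (`runsIn_fetch`), and `N`
makes polynomially many steps. The delicate resource is the space of `N`, whose input may have
length of order `n ^ c`: here `B` is decided with the smaller exponent `ε / (c + 1)`, which is
available because `B` lies in the intersection over all exponents. `compose_spec` gives the explicit
time and space bounds, and `theorem2` their asymptotics. -/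

/-! ### Bounded runs of a partial step function -/

/-- `RunsIn f safe n c d`: iterating `f` at most `n` times leads from `c` to `d`, and every
configuration that is left on the way satisfies `safe`. -/
inductive RunsIn {σ : Type*} (f : σ → Option σ) (safe : σ → Prop) : ℕ → σ → σ → Prop
  | refl (n : ℕ) (c : σ) : RunsIn f safe n c c
  | step {n : ℕ} {c d e : σ} (hc : safe c) (hf : f c = some d) (h : RunsIn f safe n d e) :
      RunsIn f safe (n + 1) c e

namespace RunsIn

variable {σ : Type*} {f : σ → Option σ} {safe : σ → Prop}

theorem mono {m n : ℕ} {c d : σ} (h : RunsIn f safe m c d) (hmn : m ≤ n) :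
    RunsIn f safe n c d := by
  induction h generalizing n with
  | refl => exact .refl _ _
  | step hc hf _ ih =>
    obtain ⟨n, rfl⟩ := Nat.exists_eq_add_of_le' (Nat.one_le_of_lt hmn)
    exact .step hc hf (ih (by omega))

theorem trans {m n : ℕ} {c d e : σ} (h : RunsIn f safe m c d) (h' : RunsIn f safe n d e) :
    RunsIn f safe (m + n) c e := by
  induction h with
  | refl => exact h'.mono (by omega)
  | step hc hf _ ih => exact (RunsIn.step hc hf (ih h')).mono (by omega)

theorem single {c d : σ} (hc : safe c) (hf : f c = some d) : RunsIn f safe 1 c d :=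
  .step hc hf (.refl _ _)

theorem map {τ : Type*} {g : τ → Option τ} {safe' : τ → Prop} (φ : σ → τ)
    (hstep : ∀ c d, f c = some d → g (φ c) = some (φ d)) (hsafe : ∀ c, safe c → safe' (φ c))
    {n : ℕ} {c d : σ} (h : RunsIn f safe n c d) : RunsIn g safe' n (φ c) (φ d) := by
  induction h with
  | refl => exact .refl _ _
  | step hc hf _ ih => exact .step (hsafe _ hc) (hstep _ _ hf) ih

end RunsIn

/-! ### Runs and computations of a single machine -/

namespace OfflineTM

variable {α β : Type}

theorem config_succ_of_step (M : OfflineTM α β) {x : List α} {t : ℕ} {c : M.Cfg}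
    (h : M.step x (M.config x t) = some c) : M.config x (t + 1) = c := by
  simp [config, h]

theorem config_of_halts (M : OfflineTM α β) {x : List α} {t : ℕ} (h : M.HaltsWithin x t) {u : ℕ}
    (hu : t ≤ u) : M.config x u = M.config x t := by
  induction u, hu using Nat.le_induction with
  | base => rfl
  | succ u _ ih =>
    have : M.step x (M.config x u) = none := by rw [ih]; exact h
    rw [config, this, ih, Option.getD_none]

theorem HaltsWithin.mono {M : OfflineTM α β} {x : List α} {t u : ℕ} (h : M.HaltsWithin x t)
    (hu : t ≤ u) : M.HaltsWithin x u := by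
  unfold HaltsWithin
  rw [M.config_of_halts h hu]
  exact h

/-- By determinism, a run starting at a configuration of the computation is a segment of that
computation. -/
theorem exists_config_of_runsIn (M : OfflineTM α β) {x : List α} {safe : M.Cfg → Prop} {n : ℕ}
    {c d : M.Cfg} (h : RunsIn (M.step x) safe n c d) :
    ∀ a, c = M.config x a →
      ∃ t ≤ n, d = M.config x (a + t) ∧ ∀ u < t, safe (M.config x (a + u)) := by
  induction h with
  | refl n c => exact fun a ha => ⟨0, by omega, ha, by simp⟩
  | step hc hf _ ih =>
    intro a ha
    subst ha
    obtain ⟨t, ht, hd, hs⟩ := ih (a + 1) (M.config_succ_of_step hf).symm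
    refine ⟨t + 1, by omega, by rw [hd]; congr 1; omega, ?_⟩
    rintro (_ | u) hu
    · exact hc
    · have := hs u (by omega)
      rwa [show a + 1 + u = a + (u + 1) by omega] at this

/-- A safe run from the initial configuration to a halting configuration determines the whole
computation. -/
theorem halts_of_runsIn (M : OfflineTM α β) {x : List α} {s n : ℕ} {d : M.Cfg}
    (h : RunsIn (M.step x) (fun c => ∀ k, c.head k < s) n M.init d) (hd : M.step x d = none)
    (hs : ∀ k, d.head k < s) :
    M.HaltsWithin x n ∧ M.UsesSpace x s ∧ M.config x n = d := by
  obtain ⟨t, ht, rfl, hsafe⟩ := M.exists_config_of_runsIn h 0 rfl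
  simp only [zero_add] at *
  have hh : M.HaltsWithin x t := hd
  refine ⟨hh.mono ht, fun u => ?_, M.config_of_halts hh ht⟩
  rcases lt_or_ge u t with hu | hu
  · exact hsafe u hu
  · rw [M.config_of_halts hh hu]; exact hs

theorem inHead_config_le (M : OfflineTM α β) (x : List α) (t : ℕ) :
    (M.config x t).inHead ≤ x.length + 1 := by
  induction t with
  | zero => simp [config, init]
  | succ t ih =>
    rw [config]
    cases h : M.step x (M.config x t) with
    | none => simpa using ih
    | some c =>
      simp only [step, Option.map_eq_some_iff] at h
      obtain ⟨a, _, rfl⟩ := h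
      simp

theorem out_prefix (M : OfflineTM α β) (x : List α) {t u : ℕ} (h : t ≤ u) :
    (M.config x t).out <+: (M.config x u).out := by
  induction u, h using Nat.le_induction with
  | base => exact List.prefix_rfl
  | succ u _ ih =>
    refine ih.trans ?_
    rw [config]
    cases h : M.step x (M.config x u) with
    | none => simp
    | some c =>
      simp only [step, Option.map_eq_some_iff] at h
      obtain ⟨a, _, rfl⟩ := h
      simp

/-- Each step emits at most one letter. Applied to the reduction, this bounds the length of `f x` by
the running time. -/
theorem length_out_le (M : OfflineTM α β) (x : List α) (t : ℕ) :
    (M.config x t).out.length ≤ t := by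
  induction t with
  | zero => simp [config, init]
  | succ t ih =>
    rw [config]
    cases h : M.step x (M.config x t) with
    | none => simp; omega
    | some c =>
      simp only [step, Option.map_eq_some_iff] at h
      obtain ⟨a, _, rfl⟩ := h
      have : a.emit.toList.length ≤ 1 := by cases a.emit <;> simp
      simp
      omega

end OfflineTM

/-! ### A pair of binary counters on one tape -/

/-- The value of a binary number, least significant digit first. -/
def binaryValue : List Bool → ℕ
  | [] => 0
  | b :: l => b.toNat + 2 * binaryValue l

theorem binaryValue_lt (l : List Bool) : binaryValue l < 2 ^ l.length := by
  induction l with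
  | nil => simp [binaryValue]
  | cons b l ih =>
    have := Bool.toNat_le b
    simp only [binaryValue, List.length_cons, pow_succ]
    omega

/-- What a pass over the counter tape is made for: to move the first counter and reset the second
one, continuing with state `q` of the second machine; or to count a letter `b` emitted by the first
machine, while the machines are in the states `r` and `q`. -/
inductive SweepTask (Q R β : Type) where
  | move (d : HeadMove) (q : Q)
  | count (q : Q) (r : R) (b : β)

namespace SweepTask

variable {Q R β : Type}

/-- The treatment of one pair of digits; the Boolean state consists of the carry and of the flag
that says whether, so far, the first counter is zero (`move`) or both counters agree (`count`). -/
def digit (w : SweepTask Q R β) (carry flag : Bool) (d : Bool × Bool) :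
    (Bool × Bool) × Bool × Bool :=
  match w with
  | move .left _ => (((d.1 ^^ carry), false), (!d.1 && carry), (flag && !(d.1 ^^ carry)))
  | move .stay _ => ((d.1, false), false, (flag && !d.1))
  | move .right _ => (((d.1 ^^ carry), false), (d.1 && carry), (flag && !(d.1 ^^ carry)))
  | count _ _ _ => ((d.1, (d.2 ^^ carry)), (d.2 && carry), (flag && (d.1 == (d.2 ^^ carry))))

/-- The treatment of the first cell after the counters: possibly a new pair of digits, and the
final value of the flag. -/
def finish (w : SweepTask Q R β) (carry flag : Bool) : Option (Bool × Bool) × Bool :=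
  match w with
  | move .right _ => if carry then (some (true, false), false) else (none, flag)
  | move _ _ => (none, flag)
  | count _ _ _ => if carry then (some (false, true), false) else (none, flag)

/-- The result of a whole pass. -/
def pass (w : SweepTask Q R β) (carry flag : Bool) :
    List (Bool × Bool) → List (Bool × Bool) × Bool
  | [] => ((w.finish carry flag).1.toList, (w.finish carry flag).2)
  | d :: l =>
    ((w.digit carry flag d).1 ::
        (w.pass (w.digit carry flag d).2.1 (w.digit carry flag d).2.2 l).1,
      (w.pass (w.digit carry flag d).2.1 (w.digit carry flag d).2.2 l).2)

end SweepTask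

/-- The value of the first of the two counters. -/
def fstCounter (l : List (Bool × Bool)) : ℕ := binaryValue (l.map Prod.fst)

/-- The value of the second of the two counters. -/
def sndCounter (l : List (Bool × Bool)) : ℕ := binaryValue (l.map Prod.snd)

@[simp] theorem fstCounter_nil : fstCounter [] = 0 := rfl

@[simp] theorem sndCounter_nil : sndCounter [] = 0 := rfl

@[simp] theorem fstCounter_cons (d : Bool × Bool) (l : List (Bool × Bool)) :
    fstCounter (d :: l) = d.1.toNat + 2 * fstCounter l := rfl

@[simp] theorem sndCounter_cons (d : Bool × Bool) (l : List (Bool × Bool)) :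
    sndCounter (d :: l) = d.2.toNat + 2 * sndCounter l := rfl

theorem fstCounter_lt (l : List (Bool × Bool)) : fstCounter l < 2 ^ l.length := by
  simpa [fstCounter] using binaryValue_lt (l.map Prod.fst)

theorem sndCounter_lt (l : List (Bool × Bool)) : sndCounter l < 2 ^ l.length := by
  simpa [sndCounter] using binaryValue_lt (l.map Prod.snd)

namespace SweepTask

variable {Q R β : Type}

/-- A pass is needed even when the head stays: it resets the second counter and tests the first one
for zero. -/
theorem pass_stay (q : Q) (l : List (Bool × Bool)) (carry flag : Bool) :
    fstCounter ((move .stay q : SweepTask Q R β).pass carry flag l).1 = fstCounter l ∧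
      sndCounter ((move .stay q : SweepTask Q R β).pass carry flag l).1 = 0 ∧
      ((move .stay q : SweepTask Q R β).pass carry flag l).1.length = l.length ∧
      (((move .stay q : SweepTask Q R β).pass carry flag l).2 = true ↔
        flag = true ∧ fstCounter l = 0) := by
  induction l generalizing carry flag with
  | nil => simp [pass, finish]
  | cons d l ih =>
    obtain ⟨h1, h2, h3, h4⟩ := ih (digit (move .stay q : SweepTask Q R β) carry flag d).2.1
      (digit (move .stay q : SweepTask Q R β) carry flag d).2.2
    obtain ⟨a, b⟩ := d
    simp only [pass, fstCounter_cons, sndCounter_cons, List.length_cons, h1, h2, h3, h4]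
    cases a <;> cases flag <;> simp [digit]

/-- The carry survives to the end only if all digits of the first counter are `1`, so a new digit
appears only when the value reaches a power of two. This is what keeps the number of digits
logarithmic. -/
theorem pass_right (q : Q) (l : List (Bool × Bool)) (carry flag : Bool) :
    fstCounter ((move .right q : SweepTask Q R β).pass carry flag l).1 =
        fstCounter l + carry.toNat ∧
      sndCounter ((move .right q : SweepTask Q R β).pass carry flag l).1 = 0 ∧
      (((move .right q : SweepTask Q R β).pass carry flag l).1.length = l.length ∨
        ((move .right q : SweepTask Q R β).pass carry flag l).1.length = l.length + 1 ∧
          fstCounter l + carry.toNat = 2 ^ l.length) ∧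
      (((move .right q : SweepTask Q R β).pass carry flag l).2 = true ↔
        flag = true ∧ fstCounter l + carry.toNat = 0) := by
  induction l generalizing carry flag with
  | nil => cases carry <;> simp [pass, finish]
  | cons d l ih =>
    obtain ⟨h1, h2, h3, h4⟩ := ih (digit (move .right q : SweepTask Q R β) carry flag d).2.1
      (digit (move .right q : SweepTask Q R β) carry flag d).2.2
    obtain ⟨a, b⟩ := d
    simp only [pass, fstCounter_cons, sndCounter_cons, List.length_cons, h1, h2, h4]
    have hlt := fstCounter_lt l
    cases a <;> cases flag <;> cases carry <;> simp [digit, pow_succ] at h3 ⊢ <;> omega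

/-- Here `carry` is a borrow. The hypothesis `hl` guarantees that some digit absorbs it, so there is
no underflow. -/
theorem pass_left (q : Q) (l : List (Bool × Bool)) (carry flag : Bool)
    (hl : carry.toNat ≤ fstCounter l) :
    fstCounter ((move .left q : SweepTask Q R β).pass carry flag l).1 + carry.toNat =
        fstCounter l ∧
      sndCounter ((move .left q : SweepTask Q R β).pass carry flag l).1 = 0 ∧
      ((move .left q : SweepTask Q R β).pass carry flag l).1.length = l.length ∧
      (((move .left q : SweepTask Q R β).pass carry flag l).2 = true ↔
        flag = true ∧ fstCounter l = carry.toNat) := by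
  induction l generalizing carry flag with
  | nil => simp at hl; simp [pass, finish, hl]
  | cons d l ih =>
    obtain ⟨a, b⟩ := d
    have := ih (digit (move .left q : SweepTask Q R β) carry flag (a, b)).2.1
      (digit (move .left q : SweepTask Q R β) carry flag (a, b)).2.2
      (by cases a <;> cases carry <;> simp [digit] at hl ⊢; omega)
    obtain ⟨h1, h2, h3, h4⟩ := this
    simp only [pass, fstCounter_cons, sndCounter_cons, List.length_cons, h2, h3, h4]
    cases a <;> cases flag <;> cases carry <;> simp [digit] at h1 ⊢ <;> omega

theorem pass_count (q : Q) (r : R) (b : β) (l : List (Bool × Bool)) (carry flag : Bool) :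
    fstCounter ((count q r b).pass carry flag l).1 = fstCounter l ∧
      sndCounter ((count q r b).pass carry flag l).1 = sndCounter l + carry.toNat ∧
      (((count q r b).pass carry flag l).1.length = l.length ∨
        ((count q r b).pass carry flag l).1.length = l.length + 1 ∧
          sndCounter l + carry.toNat = 2 ^ l.length) ∧
      (((count q r b).pass carry flag l).2 = true ↔
        flag = true ∧ fstCounter l = sndCounter l + carry.toNat) := by
  induction l generalizing carry flag with
  | nil => cases carry <;> simp [pass, finish]
  | cons d l ih =>
    obtain ⟨h1, h2, h3, h4⟩ := ih (digit (count q r b) carry flag d).2.1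
      (digit (count q r b) carry flag d).2.2
    obtain ⟨a, b'⟩ := d
    simp only [pass, fstCounter_cons, sndCounter_cons, List.length_cons, h1, h2, h4]
    have hlt := sndCounter_lt l
    cases a <;> cases b' <;> cases flag <;> cases carry <;> simp [digit, pow_succ] at h3 ⊢ <;> omega

end SweepTask

namespace SweepTask

variable {Q R β : Type}

theorem pass_move_spec (d : HeadMove) (q : Q) (l : List (Bool × Bool))
    (hd : d = .left → fstCounter l ≠ 0) :
    fstCounter ((move d q : SweepTask Q R β).pass true true l).1 = d.apply (fstCounter l) ∧
      sndCounter ((move d q : SweepTask Q R β).pass true true l).1 = 0 ∧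
      (((move d q : SweepTask Q R β).pass true true l).2 = true ↔ d.apply (fstCounter l) = 0) ∧
      ∀ W, l.length ≤ W → d.apply (fstCounter l) < 2 ^ W →
        ((move d q : SweepTask Q R β).pass true true l).1.length ≤ W := by
  cases d with
  | left =>
    have h0 := hd rfl
    obtain ⟨h1, h2, h3, h4⟩ := pass_left (R := R) (β := β) q l true true
      (by simp only [Bool.toNat_true]; omega)
    simp only [Bool.toNat_true] at h1 h4
    refine ⟨by simp only [HeadMove.apply]; omega, h2, ?_, fun W hW _ => by omega⟩
    rw [h4]
    simp only [HeadMove.apply, true_and]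
    omega
  | stay =>
    obtain ⟨h1, h2, h3, h4⟩ := pass_stay (R := R) (β := β) q l true true
    exact ⟨h1, h2, by rw [h4]; simp [HeadMove.apply], fun W hW _ => by omega⟩
  | right =>
    obtain ⟨h1, h2, h3, h4⟩ := pass_right (R := R) (β := β) q l true true
    refine ⟨h1, h2, by rw [h4]; simp [HeadMove.apply], fun W hW hlt => ?_⟩
    rcases h3 with h3 | ⟨h3, h5⟩
    · omega
    · simp only [HeadMove.apply, Bool.toNat_true] at hlt h5
      rw [h5] at hlt
      have := (Nat.pow_lt_pow_iff_right (a := 2) (by norm_num)).1 hlt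
      omega

/-- The second counter stays at most equal to the first, which already fits into the available
digits; so counting never lengthens the tape. -/
theorem pass_count_spec (q : Q) (r : R) (b : β) (l : List (Bool × Bool))
    (hl : sndCounter l < fstCounter l) :
    fstCounter ((count q r b).pass true true l).1 = fstCounter l ∧
      sndCounter ((count q r b).pass true true l).1 = sndCounter l + 1 ∧
      (((count q r b).pass true true l).2 = true ↔ fstCounter l = sndCounter l + 1) ∧
      ((count q r b).pass true true l).1.length = l.length := by
  obtain ⟨h1, h2, h3, h4⟩ := pass_count q r b l true true
  have := fstCounter_lt l
  simp only [Bool.toNat_true] at *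
  exact ⟨h1, h2, by rw [h4]; simp, by omega⟩

end SweepTask

/-! ### The composed machine -/

attribute [instance] OfflineTM.finQ OfflineTM.finK OfflineTM.finΓ

/-- Replace a move beyond an end marker by no move. -/
def HeadMove.clamp {β : Type} : InputSymbol β → HeadMove → HeadMove
  | .leftEnd, .left => .stay
  | .rightEnd, .right => .stay
  | _, d => d

theorem inputAt_eq_leftEnd_iff {α : Type} (x : List α) (i : ℕ) :
    inputAt x i = .leftEnd ↔ i = 0 := by
  cases i with
  | zero => simp [inputAt]
  | succ i => cases h : x[i]? <;> simp [inputAt, h]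

/-- The composed machine does not know the length of `y`, but the scanned end marker suffices to cut
off the moves of the virtual head. The second conclusion is what excludes an underflow of the
position counter. -/
theorem HeadMove.clamp_inputAt {β : Type} (y : List β) {i : ℕ} (hi : i ≤ y.length + 1)
    (d : HeadMove) :
    (d.clamp (inputAt y i)).apply i = min (d.apply i) (y.length + 1) ∧
      (d.clamp (inputAt y i) = .left → i ≠ 0) := by
  cases i with
  | zero => cases d <;> simp [inputAt, clamp, HeadMove.apply]
  | succ i =>
    rcases lt_or_ge i y.length with h | h
    · simp only [inputAt, List.getElem?_eq_getElem h]
      cases d <;> simp [clamp, HeadMove.apply] <;> omega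
    · simp only [inputAt, List.getElem?_eq_none h]
      cases d <;> simp [clamp, HeadMove.apply] <;> omega

/-- States of the composed machine, apart from its initial state. -/
inductive SimState (Q R β : Type) where
  /-- the counter head moves to the right and executes the task -/
  | sweep (w : SweepTask Q R β) (carry flag : Bool)
  /-- the counter head returns to cell `0` -/
  | rewind (w : SweepTask Q R β) (flag : Bool)
  /-- the heads of the first machine move behind the cells it has used -/
  | clearRight (q : Q)
  /-- the heads of the first machine return to cell `0` and erase its tapes -/
  | clearLeft (q : Q)
  /-- the first machine makes a step from state `r` -/
  | runFst (q : Q) (r : R)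
  /-- the second machine makes a step from state `q`, scanning the input symbol `s` -/
  | stepSnd (q : Q) (s : InputSymbol β)

instance {β : Type} [Finite β] : Finite (InputSymbol β) :=
  Finite.of_surjective
    (fun o : Option (Option β) => match o with
      | none => InputSymbol.leftEnd
      | some none => InputSymbol.rightEnd
      | some (some b) => InputSymbol.letter b)
    (by
      rintro (_ | b | _)
      exacts [⟨none, rfl⟩, ⟨some (some b), rfl⟩, ⟨some none, rfl⟩])

instance : Finite HeadMove :=
  Finite.of_surjective
    (fun o : Option Bool => match o with
      | none => HeadMove.stay
      | some true => HeadMove.left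
      | some false => HeadMove.right)
    (by
      rintro (_ | _ | _)
      exacts [⟨some true, rfl⟩, ⟨none, rfl⟩, ⟨some false, rfl⟩])

instance {Q R β : Type} [Finite Q] [Finite R] [Finite β] : Finite (SweepTask Q R β) :=
  Finite.of_surjective
    (fun o : (HeadMove × Q) ⊕ (Q × R × β) => match o with
      | .inl (d, q) => SweepTask.move d q
      | .inr (q, r, b) => SweepTask.count q r b)
    (by
      rintro (⟨d, q⟩ | ⟨q, r, b⟩)
      exacts [⟨.inl (d, q), rfl⟩, ⟨.inr (q, r, b), rfl⟩])

instance {Q R β : Type} [Finite Q] [Finite R] [Finite β] : Finite (SimState Q R β) :=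
  Finite.of_surjective
    (fun o : (SweepTask Q R β × Bool × Bool) ⊕ (SweepTask Q R β × Bool) ⊕ Q ⊕ Q ⊕ (Q × R) ⊕
        (Q × InputSymbol β) => match o with
      | .inl (w, c, z) => SimState.sweep w c z
      | .inr (.inl (w, z)) => SimState.rewind w z
      | .inr (.inr (.inl q)) => SimState.clearRight q
      | .inr (.inr (.inr (.inl q))) => SimState.clearLeft q
      | .inr (.inr (.inr (.inr (.inl (q, r))))) => SimState.runFst q r
      | .inr (.inr (.inr (.inr (.inr (q, s))))) => SimState.stepSnd q s)
    (by
      rintro (⟨w, c, z⟩ | ⟨w, z⟩ | q | q | ⟨q, r⟩ | ⟨q, s⟩)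
      exacts [⟨.inl (w, c, z), rfl⟩, ⟨.inr (.inl (w, z)), rfl⟩, ⟨.inr (.inr (.inl q)), rfl⟩,
        ⟨.inr (.inr (.inr (.inl q))), rfl⟩, ⟨.inr (.inr (.inr (.inr (.inl (q, r))))), rfl⟩,
        ⟨.inr (.inr (.inr (.inr (.inr (q, s))))), rfl⟩])

namespace OfflineTM

variable {α β : Type} (M : OfflineTM α β) (N : OfflineTM β Empty)

/-- What the composed machine sees: the input symbol, the pair of counter digits (if any) and the
symbols on the tapes of the two machines (`none` on cells not used by the first machine), and
whether the heads are in cell `0`. -/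
structure SimView where
  input : InputSymbol α
  ctrZero : Bool
  ctr : Option (Bool × Bool)
  fstZero : M.K → Bool
  fst : M.K → Option M.Γ
  snd : N.K → N.Γ

/-- What the composed machine does in a step. -/
structure SimAction where
  state : SimState N.Q M.Q β
  inMove : HeadMove
  ctr : Option (Bool × Bool)
  ctrMove : HeadMove
  fst : M.K → Option M.Γ
  fstMove : M.K → HeadMove
  snd : N.K → N.Γ
  sndMove : N.K → HeadMove

variable {M N}

/-- The action that changes nothing but the state. -/
def SimView.idle (v : SimView M N) (st : SimState N.Q M.Q β) : SimAction M N where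
  state := st
  inMove := .stay
  ctr := v.ctr
  ctrMove := .stay
  fst := v.fst
  fstMove := fun _ => .stay
  snd := v.snd
  sndMove := fun _ => .stay

/-- The state entered when a task has been executed and its flag is `flag`. -/
def afterPass {Q R β : Type} : SweepTask Q R β → Bool → SimState Q R β
  | .move _ q, flag => if flag then .stepSnd q .leftEnd else .clearRight q
  | .count q r b, flag => if flag then .stepSnd q (.letter b) else .runFst q r

variable (M N)

open Classical in
/-- The transition function of the composed machine. -/
noncomputable def simδ : SimState N.Q M.Q β → SimView M N → Option (SimAction M N)
  | .sweep w c z, v =>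
    match v.ctr with
    | some d =>
      some { v.idle (.sweep w (w.digit c z d).2.1 (w.digit c z d).2.2) with
        ctr := some (w.digit c z d).1, ctrMove := .right }
    | none => some { v.idle (.rewind w (w.finish c z).2) with ctr := (w.finish c z).1 }
  | .rewind w z, v =>
    if v.ctrZero then some (v.idle (afterPass w z))
    else some { v.idle (.rewind w z) with ctrMove := .left }
  | .clearRight q, v =>
    if ∀ k, v.fst k = none then some (v.idle (.clearLeft q))
    else some { v.idle (.clearRight q) with
      fstMove := fun k => if v.fst k = none then .stay else .right }
  | .clearLeft q, v =>
    some { v.idle (if (∀ k, v.fstZero k = true) ∧ v.input = .leftEnd then .runFst q M.start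
        else .clearLeft q) with
      inMove := .left, fst := fun _ => none, fstMove := fun _ => .left }
  | .runFst q r, v =>
    match M.δ r v.input (fun k => (v.fst k).getD M.blank) with
    | none => some (v.idle (.stepSnd q .rightEnd))
    | some a =>
      some { v.idle (match a.emit with
          | none => .runFst q a.state
          | some b => .sweep (.count q a.state b) true true) with
        inMove := a.inMove, fst := fun k => some (a.write k), fstMove := a.move }
  | .stepSnd q s, v =>
    (N.δ q s v.snd).map fun a =>
      { v.idle (.sweep (.move (a.inMove.clamp s) a.state) true true) with
        snd := a.write, sndMove := a.move }

/-- Configurations of the composed machine, without the marks in the cells `0`. -/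
structure SimCfg where
  state : SimState N.Q M.Q β
  inHead : ℕ
  ctr : ℕ → Option (Bool × Bool)
  ctrHead : ℕ
  fst : M.K → ℕ → Option M.Γ
  fstHead : M.K → ℕ
  snd : N.K → ℕ → N.Γ
  sndHead : N.K → ℕ

variable {M N}

/-- What the composed machine sees in a configuration. -/
def SimCfg.view (x : List α) (c : SimCfg M N) : SimView M N where
  input := inputAt x c.inHead
  ctrZero := decide (c.ctrHead = 0)
  ctr := c.ctr c.ctrHead
  fstZero := fun k => decide (c.fstHead k = 0)
  fst := fun k => c.fst k (c.fstHead k)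
  snd := fun k => c.snd k (c.sndHead k)

/-- The effect of an action on a configuration. -/
def SimCfg.act (x : List α) (c : SimCfg M N) (a : SimAction M N) : SimCfg M N where
  state := a.state
  inHead := min (a.inMove.apply c.inHead) (x.length + 1)
  ctr := Function.update c.ctr c.ctrHead a.ctr
  ctrHead := a.ctrMove.apply c.ctrHead
  fst := fun k => Function.update (c.fst k) (c.fstHead k) (a.fst k)
  fstHead := fun k => (a.fstMove k).apply (c.fstHead k)
  snd := fun k => Function.update (c.snd k) (c.sndHead k) (a.snd k)
  sndHead := fun k => (a.sndMove k).apply (c.sndHead k)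

/-- One step of the composed machine. -/
noncomputable def simStep (x : List α) (c : SimCfg M N) : Option (SimCfg M N) :=
  (simδ M N c.state (c.view x)).map (c.act x)

variable (M N)

/-- The machine that simulates `N` on the output of `M`, recomputing each letter of this output
when it is needed. The first step marks the cells `0` of all work tapes. -/
noncomputable def compose [Finite β] : OfflineTM α Empty where
  Q := Option (SimState N.Q M.Q β)
  K := Option (M.K ⊕ N.K)
  Γ := Bool × Option (Bool × Bool) × Option M.Γ × N.Γ
  start := none
  blank := (false, none, none, N.blank)
  accept := {st | ∃ q ∈ N.accept, ∃ s, st = some (.stepSnd q s)}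
  δ
    | none, _, _ =>
      some
        { state := some (.sweep (.move .stay N.start) true true)
          inMove := .stay
          write := fun _ => (true, none, none, N.blank)
          move := fun _ => .stay
          emit := none }
    | some st, s, t =>
      (simδ M N st
        { input := s
          ctrZero := (t none).1
          ctr := (t none).2.1
          fstZero := fun k => (t (some (.inl k))).1
          fst := fun k => (t (some (.inl k))).2.2.1
          snd := fun k => (t (some (.inr k))).2.2.2 }).map fun a =>
        { state := some a.state
          inMove := a.inMove
          write := fun
            | none => ((t none).1, a.ctr, none, N.blank)
            | some (.inl k) => ((t (some (.inl k))).1, none, a.fst k, N.blank)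
            | some (.inr k) => ((t (some (.inr k))).1, none, none, a.snd k)
          move := fun
            | none => a.ctrMove
            | some (.inl k) => a.fstMove k
            | some (.inr k) => a.sndMove k
          emit := none }

variable {M N}

/-- The configuration of the composed machine with the marks in the cells `0`. -/
def SimCfg.toCfg [Finite β] (c : SimCfg M N) : (compose M N).Cfg where
  state := some c.state
  inHead := c.inHead
  tape
    | none => fun p => (decide (p = 0), c.ctr p, none, N.blank)
    | some (.inl k) => fun p => (decide (p = 0), none, c.fst k p, N.blank)
    | some (.inr k) => fun p => (decide (p = 0), none, none, c.snd k p)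
  head
    | none => c.ctrHead
    | some (.inl k) => c.fstHead k
    | some (.inr k) => c.sndHead k
  out := []

variable (M N)

/-- The configuration of the composed machine after its first step. -/
def simInit : SimCfg M N where
  state := .sweep (.move .stay N.start) true true
  inHead := 0
  ctr := fun _ => none
  ctrHead := 0
  fst := fun _ _ => none
  fstHead := fun _ => 0
  snd := fun _ _ => N.blank
  sndHead := fun _ => 0

theorem compose_step_init [Finite β] (x : List α) :
    (compose M N).step x (compose M N).init = some (simInit M N).toCfg := by
  have key : Function.update (fun _ : ℕ => (false, (none : Option (Bool × Bool)),
      (none : Option M.Γ), N.blank)) 0 (true, none, none, N.blank) =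
      fun p => (decide (p = 0), none, none, N.blank) := by
    funext p
    by_cases hp : p = 0 <;> simp [hp]
  simp only [step, init, compose, Option.map_some, SimCfg.toCfg, simInit, HeadMove.apply,
    Option.some.injEq]
  congr 1
  · funext k
    rcases k with _ | k | k <;> exact key
  · funext k
    rcases k with _ | k | k <;> rfl

variable {M N}

/-- After the first step the marks in the cells `0` are never changed, so the rest of the analysis
can be done on `SimCfg`, where they are implicit. -/
theorem compose_step_toCfg [Finite β] (x : List α) (c : SimCfg M N) :
    (compose M N).step x c.toCfg = (simStep x c).map SimCfg.toCfg := by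
  have key {τ : Type} (g : ℕ → τ) (h : ℕ) (w : τ) {ρ : Type} (e : Bool → τ → ρ) :
      Function.update (fun p => e (decide (p = 0)) (g p)) h (e (decide (h = 0)) w) =
        fun p => e (decide (p = 0)) (Function.update g h w p) := by
    funext p
    by_cases hp : p = h
    · subst hp; simp
    · simp [hp]
  refine (Option.map_map _ _ (simδ M N c.state (c.view x))).trans ?_
  rw [simStep, Option.map_map]
  congr 1
  funext a
  simp only [Function.comp, SimCfg.act, SimCfg.toCfg, Option.toList_none, List.append_nil]
  congr 1
  · funext k
    rcases k with _ | k | k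
    · exact key c.ctr c.ctrHead a.ctr (fun b d => (b, d, none, N.blank))
    · exact key (c.fst k) (c.fstHead k) (a.fst k) (fun b d => (b, none, d, N.blank))
    · exact key (c.snd k) (c.sndHead k) (a.snd k) (fun b d => (b, none, none, d))
  · funext k
    rcases k with _ | k | k <;> rfl

end OfflineTM

/-! ### Subroutines of the composed machine: counter passes and erasing -/

namespace OfflineTM

variable {α β : Type} {M : OfflineTM α β} {N : OfflineTM β Empty}

/-- All heads of the composed machine are in the first `s` cells. -/
def SimCfg.Within (s : ℕ) (c : SimCfg M N) : Prop :=
  c.ctrHead < s ∧ (∀ k, c.fstHead k < s) ∧ ∀ k, c.sndHead k < s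

theorem simStep_sweep_some {x : List α} {c : SimCfg M N} {w : SweepTask N.Q M.Q β}
    {carry flag : Bool} {d : Bool × Bool} (hc : c.inHead ≤ x.length + 1)
    (hs : c.state = .sweep w carry flag) (hd : c.ctr c.ctrHead = some d) :
    simStep x c = some { c with
      state := .sweep w (w.digit carry flag d).2.1 (w.digit carry flag d).2.2
      ctr := Function.update c.ctr c.ctrHead (some (w.digit carry flag d).1)
      ctrHead := c.ctrHead + 1 } := by
  simp [simStep, simδ, SimCfg.view, SimCfg.act, SimView.idle, HeadMove.apply, hs, hd, hc]

theorem simStep_sweep_none {x : List α} {c : SimCfg M N} {w : SweepTask N.Q M.Q β}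
    {carry flag : Bool} (hc : c.inHead ≤ x.length + 1)
    (hs : c.state = .sweep w carry flag) (hd : c.ctr c.ctrHead = none) :
    simStep x c = some { c with
      state := .rewind w (w.finish carry flag).2
      ctr := Function.update c.ctr c.ctrHead (w.finish carry flag).1 } := by
  simp [simStep, simδ, SimCfg.view, SimCfg.act, SimView.idle, HeadMove.apply, hs, hd, hc]

theorem simStep_rewind {x : List α} {c : SimCfg M N} {w : SweepTask N.Q M.Q β}
    {flag : Bool} (hc : c.inHead ≤ x.length + 1) (hs : c.state = .rewind w flag) :
    simStep x c = some { c with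
      state := if c.ctrHead = 0 then afterPass w flag else .rewind w flag
      ctrHead := c.ctrHead - 1 } := by
  by_cases h : c.ctrHead = 0 <;>
    simp [simStep, simδ, SimCfg.view, SimCfg.act, SimView.idle, HeadMove.apply, hs, h, hc]

/-- Induction on the digits `l` still to be treated; `pre` collects those already rewritten, to the
left of the head. -/
theorem runsIn_sweep {x : List α} {s : ℕ} {c : SimCfg M N} {w : SweepTask N.Q M.Q β}
    (hc : c.inHead ≤ x.length + 1) (hf : ∀ k, c.fstHead k < s) (hsn : ∀ k, c.sndHead k < s)
    (l pre : List (Bool × Bool)) (carry flag : Bool) (hl : pre.length + l.length < s) :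
    RunsIn (simStep x) (SimCfg.Within s) (l.length + 1)
      { c with state := .sweep w carry flag, ctr := fun p => (pre ++ l)[p]?,
               ctrHead := pre.length }
      { c with state := .rewind w (w.pass carry flag l).2,
               ctr := fun p => (pre ++ (w.pass carry flag l).1)[p]?,
               ctrHead := pre.length + l.length } := by
  induction l generalizing pre carry flag with
  | nil =>
    refine RunsIn.single ⟨by simpa using hl, hf, hsn⟩ ?_
    refine Eq.trans (simStep_sweep_none hc rfl (by simp)) ?_
    simp only [Option.some.injEq, SimCfg.mk.injEq, true_and, and_true, SweepTask.pass]
    refine ⟨?_, by simp⟩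
    funext p
    cases h : (w.finish carry flag).1 with
    | none =>
      by_cases hp : p = pre.length <;> simp [hp]
    | some d =>
      rcases lt_trichotomy p pre.length with hp | hp | hp
      · rw [Function.update_of_ne hp.ne]; simp [List.getElem?_append_left hp]
      · simp [hp]
      · rw [Function.update_of_ne hp.ne', List.getElem?_eq_none (by simp; omega),
          List.getElem?_eq_none (by simp; omega)]
  | cons d l ih =>
    refine RunsIn.step ⟨by simp at hl ⊢; omega, hf, hsn⟩
      (simStep_sweep_some (d := d) hc rfl (by simp)) ?_
    have := ih (pre ++ [(w.digit carry flag d).1]) (w.digit carry flag d).2.1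
      (w.digit carry flag d).2.2 (by simp at hl ⊢; omega)
    simp only [List.append_assoc, List.singleton_append, List.length_append,
      List.length_singleton] at this
    have hupd : Function.update (fun p => (pre ++ d :: l)[p]?) pre.length
        (some (w.digit carry flag d).1) = fun p => (pre ++ (w.digit carry flag d).1 :: l)[p]? := by
      funext p
      rcases lt_trichotomy p pre.length with hp | hp | hp
      · rw [Function.update_of_ne hp.ne]; simp [List.getElem?_append_left hp]
      · simp [hp]
      · rw [Function.update_of_ne hp.ne', List.getElem?_append_right hp.le,
          List.getElem?_append_right hp.le]
        obtain ⟨j, rfl⟩ := Nat.exists_eq_add_of_lt hp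
        simp [show pre.length + j + 1 - pre.length = j + 1 by omega]
    rw [List.length_cons, show pre.length + (l.length + 1) = pre.length + 1 + l.length by omega]
    dsimp only
    rw [hupd]
    exact this

theorem runsIn_rewind {x : List α} {s : ℕ} {c : SimCfg M N} {w : SweepTask N.Q M.Q β}
    (hc : c.inHead ≤ x.length + 1) (hf : ∀ k, c.fstHead k < s) (hsn : ∀ k, c.sndHead k < s)
    (flag : Bool) (h : ℕ) (hh : h < s) :
    RunsIn (simStep x) (SimCfg.Within s) (h + 1)
      { c with state := .rewind w flag, ctrHead := h }
      { c with state := afterPass w flag, ctrHead := 0 } := by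
  induction h with
  | zero =>
    exact RunsIn.single ⟨hh, hf, hsn⟩ (Eq.trans (simStep_rewind hc rfl) (by simp))
  | succ h ih =>
    refine RunsIn.step ⟨hh, hf, hsn⟩ (simStep_rewind hc rfl) ?_
    simpa using ih (by omega)

theorem runsIn_task {x : List α} {s : ℕ} {c : SimCfg M N} {w : SweepTask N.Q M.Q β}
    {l : List (Bool × Bool)} (hc : c.inHead ≤ x.length + 1) (hf : ∀ k, c.fstHead k < s)
    (hsn : ∀ k, c.sndHead k < s) (hl : l.length < s) (hst : c.state = .sweep w true true)
    (hctr : c.ctr = fun p => l[p]?) (hh : c.ctrHead = 0) :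
    RunsIn (simStep x) (SimCfg.Within s) (2 * l.length + 2) c
      { c with state := afterPass w (w.pass true true l).2,
               ctr := fun p => (w.pass true true l).1[p]? } := by
  have h1 := runsIn_sweep (w := w) hc hf hsn l [] true true (by simpa using hl)
  have h2 := runsIn_rewind (x := x) (s := s)
    (c := { c with ctr := fun p => (w.pass true true l).1[p]? }) (w := w) hc hf hsn
    (w.pass true true l).2 l.length hl
  simp only [List.nil_append, List.length_nil, zero_add] at h1
  have h3 := (h1.trans h2).mono (show _ ≤ 2 * l.length + 2 by omega)
  obtain ⟨⟩ := c
  simp only at hst hctr hh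
  subst hst hctr hh
  exact h3

/-- The cells used by the first machine are initial segments of its tapes, of length at most `s`,
possibly followed by the head. -/
def SimCfg.FstUsed (s : ℕ) (c : SimCfg M N) : Prop :=
  ∃ v : M.K → ℕ, (∀ k p, (c.fst k p).isSome ↔ p < v k) ∧ ∀ k, c.fstHead k ≤ v k ∧ v k ≤ s

theorem simStep_clearRight_of_forall {x : List α} {c : SimCfg M N} {q : N.Q}
    (hc : c.inHead ≤ x.length + 1) (hs : c.state = .clearRight q)
    (h : ∀ k, c.fst k (c.fstHead k) = none) :
    simStep x c = some { c with state := .clearLeft q } := by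
  simp [simStep, simδ, SimCfg.view, SimCfg.act, SimView.idle, HeadMove.apply, hs, hc, h]
  funext k
  rw [← h k, Function.update_eq_self]

open Classical in
theorem simStep_clearRight_of_not {x : List α} {c : SimCfg M N} {q : N.Q}
    (hc : c.inHead ≤ x.length + 1) (hs : c.state = .clearRight q)
    (h : ¬ ∀ k, c.fst k (c.fstHead k) = none) :
    simStep x c = some { c with
      fstHead := fun k =>
        if c.fst k (c.fstHead k) = none then c.fstHead k else c.fstHead k + 1 } := by
  simp only [simStep, simδ, SimCfg.view, hs, if_neg h]
  simp [SimCfg.act, SimView.idle, HeadMove.apply, hc]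
  funext k
  split_ifs <;> rfl

open Classical in
theorem simStep_clearLeft {x : List α} {c : SimCfg M N} {q : N.Q}
    (hc : c.inHead ≤ x.length + 1) (hs : c.state = .clearLeft q) :
    simStep x c = some { c with
      state := if (∀ k, c.fstHead k = 0) ∧ c.inHead = 0 then .runFst q M.start else .clearLeft q
      inHead := c.inHead - 1
      fst := fun k => Function.update (c.fst k) (c.fstHead k) none
      fstHead := fun k => c.fstHead k - 1 } := by
  simp only [simStep, simδ, SimCfg.view, hs, inputAt_eq_leftEnd_iff, decide_eq_true_eq]
  simp [SimCfg.act, SimView.idle, HeadMove.apply]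
  omega

/-- The used cells form an initial segment, so each head recognises its end by the first `none` and
waits there for the others; `m` bounds the longest remaining distance. -/
theorem runsIn_clearRight {x : List α} {s : ℕ} {q : N.Q} (v : M.K → ℕ) (hv : ∀ k, v k < s)
    (m : ℕ) (c : SimCfg M N) (hc : c.inHead ≤ x.length + 1) (hctr : c.ctrHead < s)
    (hsn : ∀ k, c.sndHead k < s) (hst : c.state = .clearRight q)
    (hfst : ∀ k p, (c.fst k p).isSome ↔ p < v k) (hle : ∀ k, c.fstHead k ≤ v k)
    (hm : ∀ k, v k ≤ c.fstHead k + m) :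
    RunsIn (simStep x) (SimCfg.Within s) (m + 1) c
      { c with state := .clearLeft q, fstHead := v } := by
  have hw : c.Within s := ⟨hctr, fun k => (hle k).trans_lt (hv k), hsn⟩
  have hnone : ∀ k, c.fst k (c.fstHead k) = none ↔ c.fstHead k = v k := fun k => by
    rw [← Option.not_isSome_iff_eq_none, hfst]
    have := hle k
    omega
  induction m generalizing c with
  | zero =>
    have hh : c.fstHead = v := funext fun k => le_antisymm (hle k) (hm k)
    refine RunsIn.single hw ?_
    rw [simStep_clearRight_of_forall hc hst (fun k => (hnone k).2 (congrFun hh k)), hh]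
  | succ m ih =>
    by_cases h : ∀ k, c.fst k (c.fstHead k) = none
    · have hh : c.fstHead = v := funext fun k => (hnone k).1 (h k)
      refine (RunsIn.single hw ?_).mono (by omega)
      rw [simStep_clearRight_of_forall hc hst h, hh]
    · refine RunsIn.step hw (simStep_clearRight_of_not hc hst h) ?_
      simp only [hnone]
      have hle' : ∀ k, (if c.fstHead k = v k then c.fstHead k else c.fstHead k + 1) ≤ v k := by
        intro k
        have := hle k
        split_ifs <;> omega
      refine ih _ hc hctr hsn hst hfst hle' (fun k => ?_)
        ⟨hctr, fun k => (hle' k).trans_lt (hv k), hsn⟩ (fun k => ?_)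
      · have := hm k
        have := hle k
        dsimp only
        split_ifs <;> omega
      · rw [← Option.not_isSome_iff_eq_none, hfst]
        have := hle' k
        dsimp only
        omega

/-- The invariant `hfst` says that no used cell lies to the right of its head. Heads that reach cell
`0` early remain there, since a left move has no effect, until all of them and the input head have
arrived. -/
theorem runsIn_clearLeft {x : List α} {s : ℕ} {q : N.Q} (m : ℕ) (c : SimCfg M N)
    (hc : c.inHead ≤ x.length + 1) (hw : c.Within s) (hst : c.state = .clearLeft q)
    (hfst : ∀ k p, (c.fst k p).isSome → p ≤ c.fstHead k)
    (hm : ∀ k, c.fstHead k ≤ m) (hi : c.inHead ≤ m) :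
    RunsIn (simStep x) (SimCfg.Within s) (m + 1) c
      { c with state := .runFst q M.start, inHead := 0, fst := fun _ _ => none,
               fstHead := fun _ => 0 } := by
  have fin (c : SimCfg M N) (hc : c.inHead ≤ x.length + 1) (hst : c.state = .clearLeft q)
      (hfst : ∀ k p, (c.fst k p).isSome → p ≤ c.fstHead k)
      (h : (∀ k, c.fstHead k = 0) ∧ c.inHead = 0) : simStep x c = some
      { c with state := .runFst q M.start, inHead := 0, fst := fun _ _ => none,
               fstHead := fun _ => 0 } := by
    rw [simStep_clearLeft hc hst, if_pos h]
    simp only [h.1, h.2, Option.some.injEq, SimCfg.mk.injEq, true_and, and_true]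
    funext k p
    by_cases hp : p = 0
    · simp [hp]
    · rw [Function.update_of_ne hp, ← Option.not_isSome_iff_eq_none]
      intro hh
      have := hfst k p hh
      rw [h.1] at this
      omega
  induction m generalizing c with
  | zero =>
    exact RunsIn.single hw (fin c hc hst hfst ⟨fun k => by have := hm k; omega, by omega⟩)
  | succ m ih =>
    by_cases h : (∀ k, c.fstHead k = 0) ∧ c.inHead = 0
    · exact (RunsIn.single hw (fin c hc hst hfst h)).mono (by omega)
    · refine RunsIn.step hw (simStep_clearLeft hc hst) ?_
      rw [if_neg h]
      refine ih _ (by dsimp only; omega)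
        ⟨hw.1, fun k => lt_of_le_of_lt (Nat.sub_le _ _) (hw.2.1 k), hw.2.2⟩ rfl ?_
        (fun k => by have := hm k; dsimp only; omega) (by dsimp only; omega)
      intro k p hp
      dsimp only at hp ⊢
      by_cases hpe : p = c.fstHead k
      · simp [hpe] at hp
      · rw [Function.update_of_ne hpe] at hp
        have := hfst k p hp
        omega

theorem runsIn_clear {x : List α} {s S : ℕ} {q : N.Q} {c : SimCfg M N} (hS : S < s)
    (hc : c.inHead ≤ x.length + 1) (hctr : c.ctrHead < s) (hsn : ∀ k, c.sndHead k < s)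
    (hst : c.state = .clearRight q) (hu : c.FstUsed S) :
    RunsIn (simStep x) (SimCfg.Within s) (2 * S + x.length + 3) c
      { c with state := .runFst q M.start, inHead := 0, fst := fun _ _ => none,
               fstHead := fun _ => 0 } := by
  obtain ⟨v, hv, hvS⟩ := hu
  have h1 := runsIn_clearRight v (fun k => (hvS k).2.trans_lt hS) S c hc hctr hsn hst hv
    (fun k => (hvS k).1) (fun k => (hvS k).2.trans (Nat.le_add_left _ _))
  have h2 := runsIn_clearLeft (s := s) (S + x.length + 1)
    { c with state := .clearLeft q, fstHead := v } hc
    ⟨hctr, fun k => (hvS k).2.trans_lt hS, hsn⟩ rfl (fun k p hp => ((hv k p).1 hp).le)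
    (fun k => by have := (hvS k).2; dsimp only; omega) (by dsimp only; omega)
  exact (h1.trans h2).mono (by omega)

end OfflineTM

/-! ### Correctness and cost of the simulation -/

namespace OfflineTM

variable {α β : Type} {M : OfflineTM α β} {N : OfflineTM β Empty}

/-- The counter tape holds `l`, and head positions and used cells are bounded. -/
structure SimCfg.Ready (x : List α) (W S : ℕ) (l : List (Bool × Bool)) (c : SimCfg M N) : Prop where
  inHead_le : c.inHead ≤ x.length + 1
  ctr_eq : c.ctr = fun p => l[p]?
  ctrHead_eq : c.ctrHead = 0
  length_le : l.length ≤ W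
  used : c.FstUsed S

/-- The configuration `c` of the composed machine represents the configuration `e` of the first
machine. -/
structure SimCfg.RepFst (e : M.Cfg) (c : SimCfg M N) : Prop where
  inHead_eq : c.inHead = e.inHead
  head_eq : c.fstHead = e.head
  tape_eq : ∀ k p, (c.fst k p).getD M.blank = e.tape k p

theorem SimCfg.FstUsed.lt {S s : ℕ} {c : SimCfg M N} (h : c.FstUsed S) (hS : S < s) (k : M.K) :
    c.fstHead k < s := by
  obtain ⟨v, _, hv⟩ := h
  have := hv k
  omega

theorem simStep_runFst_none {x : List α} {c : SimCfg M N} {e : M.Cfg} {q : N.Q}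
    (hc : c.inHead ≤ x.length + 1) (hs : c.state = .runFst q e.state) (he : c.RepFst e)
    (hstep : M.step x e = none) :
    simStep x c = some { c with state := .stepSnd q .rightEnd } := by
  have hδ : M.δ e.state (inputAt x e.inHead) (fun k => e.tape k (e.head k)) = none := by
    simpa [step] using hstep
  simp [simStep, simδ, SimCfg.view, SimCfg.act, SimView.idle, HeadMove.apply, hs,
    he.inHead_eq, he.head_eq, he.tape_eq, hδ]
  rw [← he.inHead_eq]
  exact hc

theorem simStep_runFst_some {x : List α} {S : ℕ} {c : SimCfg M N} {e e' : M.Cfg} {q : N.Q}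
    (hs : c.state = .runFst q e.state) (he : c.RepFst e) (hstep : M.step x e = some e')
    (hu : c.FstUsed S) (hS : ∀ k, e.head k < S) :
    ∃ d : SimCfg M N, simStep x c = some d ∧ d.RepFst e' ∧ d.FstUsed S ∧
      d.inHead ≤ x.length + 1 ∧ d.ctr = c.ctr ∧ d.ctrHead = c.ctrHead ∧ d.snd = c.snd ∧
      d.sndHead = c.sndHead ∧
      (d.state = .runFst q e'.state ∧ e'.out = e.out ∨
        ∃ b, d.state = .sweep (.count q e'.state b) true true ∧ e'.out = e.out ++ [b]) := by
  simp only [step, Option.map_eq_some_iff] at hstep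
  obtain ⟨a, hδ, rfl⟩ := hstep
  refine ⟨{ c with
    state := match a.emit with
      | none => .runFst q a.state
      | some b => .sweep (.count q a.state b) true true
    inHead := min (a.inMove.apply e.inHead) (x.length + 1)
    fst := fun k => Function.update (c.fst k) (e.head k) (some (a.write k))
    fstHead := fun k => (a.move k).apply (e.head k) }, ?_, ?_⟩
  · unfold simStep simδ
    simp only [hs, SimCfg.view, he.inHead_eq, he.head_eq, he.tape_eq, hδ]
    cases a.emit <;>
      simp [SimCfg.act, SimView.idle, HeadMove.apply, he.inHead_eq, he.head_eq]
  · obtain ⟨v, hv, hvS⟩ := hu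
    -- The head stands on a used cell or on the first unused one, so writing there extends the used
    -- segment by at most one cell.
    refine ⟨⟨?_, ?_, ?_⟩, ⟨fun k => max (v k) (e.head k + 1), ?_, ?_⟩, ?_, ?_, ?_, ?_, ?_, ?_⟩
    · simp
    · simp
    · intro k p
      by_cases hp : p = e.head k
      · simp [hp]
      · simp [Function.update_of_ne hp, he.tape_eq]
    · intro k p
      by_cases hp : p = e.head k
      · simp [hp]
      · have := (hvS k).1
        rw [he.head_eq] at this
        simp only [Function.update_of_ne hp, hv]
        omega
    · intro k
      have h1 := hvS k
      have h2 := hS k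
      simp only [he.head_eq] at h1 ⊢
      refine ⟨?_, by omega⟩
      cases a.move k <;> simp only [HeadMove.apply] <;> omega
    · simp
    · simp
    · simp
    · simp
    · simp
    · cases hem : a.emit <;> simp

theorem inputAt_of_prefix {out y : List β} {b : β} (h : out ++ [b] <+: y) :
    inputAt y (out.length + 1) = .letter b := by
  obtain ⟨z, rfl⟩ := h
  simp [inputAt]

/-- The first machine runs until it has emitted the letter with the number stored in the first
counter, or halts. -/
theorem runsIn_fst {x : List α} {y : List β} {s W S T : ℕ} {q : N.Q} (hS : S < s) (hW : W < s)
    (hT : M.HaltsWithin x T) (hy : (M.config x T).out = y) (hMS : M.UsesSpace x S) (m : ℕ) :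
    ∀ (t : ℕ) (c : SimCfg M N) (l : List (Bool × Bool)), t + m = T → c.Ready x W S l →
      c.RepFst (M.config x t) → c.state = .runFst q (M.config x t).state →
      sndCounter l = (M.config x t).out.length → sndCounter l < fstCounter l →
      (∀ k, c.sndHead k < s) →
      ∃ (d : SimCfg M N) (l' : List (Bool × Bool)),
        RunsIn (simStep x) (SimCfg.Within s) (m * (2 * W + 3) + 1) c d ∧ d.Ready x W S l' ∧
        d.state = .stepSnd q (inputAt y (fstCounter l)) ∧ fstCounter l' = fstCounter l ∧
        d.snd = c.snd ∧ d.sndHead = c.sndHead := by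
  have halt (t : ℕ) (c : SimCfg M N) (l : List (Bool × Bool)) (htT : t ≤ T) (hr : c.Ready x W S l)
      (he : c.RepFst (M.config x t)) (hst : c.state = .runFst q (M.config x t).state)
      (hj : sndCounter l = (M.config x t).out.length) (hij : sndCounter l < fstCounter l)
      (hsn : ∀ k, c.sndHead k < s) (hh : M.step x (M.config x t) = none) :
      ∃ (d : SimCfg M N) (l' : List (Bool × Bool)),
        RunsIn (simStep x) (SimCfg.Within s) 1 c d ∧ d.Ready x W S l' ∧
        d.state = .stepSnd q (inputAt y (fstCounter l)) ∧ fstCounter l' = fstCounter l ∧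
        d.snd = c.snd ∧ d.sndHead = c.sndHead := by
    refine ⟨_, l, RunsIn.single ⟨by rw [hr.ctrHead_eq]; omega, hr.used.lt hS, hsn⟩
      (simStep_runFst_none hr.inHead_le hst he hh),
      ⟨hr.inHead_le, hr.ctr_eq, hr.ctrHead_eq, hr.length_le, hr.used⟩, ?_, rfl, rfl, rfl⟩
    -- Once `M` has halted, the second counter equals the length of `y`, so the requested position
    -- lies beyond the last letter.
    rw [← M.config_of_halts hh htT, hy] at hj
    obtain ⟨i, hi⟩ := Nat.exists_eq_add_of_lt hij
    simp [inputAt, hi, List.getElem?_eq_none (show y.length ≤ sndCounter l + i by omega)]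
  induction m with
  | zero =>
    intro t c l htm hr he hst hj hij hsn
    obtain rfl : t = T := by omega
    simpa using halt t c l le_rfl hr he hst hj hij hsn hT
  | succ m ih =>
    intro t c l htm hr he hst hj hij hsn
    cases hstep : M.step x (M.config x t) with
    | none =>
      obtain ⟨d, l', h1, h2⟩ := halt t c l (by omega) hr he hst hj hij hsn hstep
      exact ⟨d, l', h1.mono (by omega), h2⟩
    | some e' =>
      obtain ⟨d, hd, hde, hdu, hdi, hdc, hdh, hds, hdsh, hcase⟩ :=
        simStep_runFst_some hst he hstep hr.used (hMS t)
      have hw : c.Within s := ⟨by rw [hr.ctrHead_eq]; omega, hr.used.lt hS, hsn⟩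
      have hrun := RunsIn.single (f := simStep x) hw hd
      rw [← M.config_succ_of_step hstep] at hde hcase
      have hdr : d.Ready x W S l :=
        ⟨hdi, hdc.trans hr.ctr_eq, hdh.trans hr.ctrHead_eq, hr.length_le, hdu⟩
      have hdsn : ∀ k, d.sndHead k < s := by rw [hdsh]; exact hsn
      have hmul : (m + 1) * (2 * W + 3) = m * (2 * W + 3) + (2 * W + 3) := by ring
      rcases hcase with ⟨hst', hout⟩ | ⟨b, hst', hout⟩
      · obtain ⟨d', l', h1, h2, h3, h4, h5, h6⟩ := ih (t + 1) d l (by omega) hdr hde hst'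
          (by rw [hout, hj]) hij hdsn
        exact ⟨d', l', (hrun.trans h1).mono (by omega), h2, h3, h4, h5.trans hds, h6.trans hdsh⟩
      · have hpass := SweepTask.pass_count_spec q (M.config x (t + 1)).state b l hij
        obtain ⟨p1, p2, p3, p4⟩ := hpass
        have htask := runsIn_task (s := s) hdi (hdu.lt hS) hdsn (hr.length_le.trans_lt hW) hst'
          hdr.ctr_eq hdr.ctrHead_eq
        have hlen := hr.length_le
        set l₁ := ((SweepTask.count q (M.config x (t + 1)).state b).pass true true l).1
        have hrun' := hrun.trans htask
        cases hflag : ((SweepTask.count q (M.config x (t + 1)).state b).pass true true l).2 with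
        | true =>
          rw [hflag] at hrun' p3
          refine ⟨_, l₁, hrun'.mono (by omega), ⟨hdi, rfl, hdr.ctrHead_eq, by omega, hdu⟩, ?_, p1,
            hds, hdsh⟩
          -- Output is never revised, so the letter just emitted is the letter of `y` at this
          -- position.
          have hpre := M.out_prefix x (show t + 1 ≤ T by omega)
          rw [hout, hy] at hpre
          rw [p3.1 rfl, hj, inputAt_of_prefix hpre]
          rfl
        | false =>
          rw [hflag] at hrun' p3
          have hne : fstCounter l ≠ sndCounter l + 1 := fun h => by simpa using p3.2 h
          obtain ⟨d', l', h1, h2, h3, h4, h5, h6⟩ := ih (t + 1)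
            { d with state := .runFst q (M.config x (t + 1)).state, ctr := fun p => l₁[p]? } l₁
            (by omega) ⟨hdi, rfl, hdr.ctrHead_eq, by omega, hdu⟩
            ⟨hde.inHead_eq, hde.head_eq, hde.tape_eq⟩ rfl
            (by rw [p2, hout, hj]; simp) (by omega) hdsn
          rw [p1] at h3 h4
          exact ⟨d', l', (hrun'.trans h1).mono (by omega), h2, h3, h4, h5.trans hds,
            h6.trans hdsh⟩

/-- The time needed to find the next input symbol of the second machine. -/
def fetchTime (n W S T : ℕ) : ℕ := (2 * W + 2) + (2 * S + n + 3) + (T * (2 * W + 3) + 1)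

/-- The input head of the second machine is moved and the symbol under it is recomputed. -/
theorem runsIn_fetch {x : List α} {y : List β} {s W S T : ℕ} {q : N.Q} {dir : HeadMove}
    {c : SimCfg M N} {l : List (Bool × Bool)} (hS : S < s) (hW : W < s)
    (hT : M.HaltsWithin x T) (hy : (M.config x T).out = y) (hMS : M.UsesSpace x S)
    (hr : c.Ready x W S l) (hst : c.state = .sweep (.move dir q) true true)
    (hdir : dir = .left → fstCounter l ≠ 0) (hle : dir.apply (fstCounter l) < 2 ^ W)
    (hsn : ∀ k, c.sndHead k < s) :
    ∃ (d : SimCfg M N) (l' : List (Bool × Bool)),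
      RunsIn (simStep x) (SimCfg.Within s) (fetchTime x.length W S T) c d ∧ d.Ready x W S l' ∧
      d.state = .stepSnd q (inputAt y (dir.apply (fstCounter l))) ∧
      fstCounter l' = dir.apply (fstCounter l) ∧ d.snd = c.snd ∧ d.sndHead = c.sndHead := by
  obtain ⟨p1, p2, p3, p4⟩ := SweepTask.pass_move_spec (R := M.Q) (β := β) dir q l hdir
  have p4 := p4 W hr.length_le hle
  have htask := runsIn_task (s := s) hr.inHead_le (hr.used.lt hS) hsn (hr.length_le.trans_lt hW) hst
    hr.ctr_eq hr.ctrHead_eq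
  have hlen := hr.length_le
  set l₁ := ((SweepTask.move dir q : SweepTask N.Q M.Q β).pass true true l).1
  cases hflag : ((SweepTask.move dir q : SweepTask N.Q M.Q β).pass true true l).2 with
  | true =>
    rw [hflag] at htask p3
    refine ⟨_, l₁, htask.mono (by unfold fetchTime; omega),
      ⟨hr.inHead_le, rfl, hr.ctrHead_eq, p4, hr.used⟩, ?_, p1, rfl, rfl⟩
    rw [p3.1 rfl]
    rfl
  | false =>
    rw [hflag] at htask p3
    have hne : dir.apply (fstCounter l) ≠ 0 := fun h => by simpa using p3.2 h
    have hclear := runsIn_clear (s := s) (q := q)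
      (c := { c with state := afterPass (.move dir q) false, ctr := fun p => l₁[p]? }) hS
      hr.inHead_le (by dsimp only; rw [hr.ctrHead_eq]; omega) hsn rfl hr.used
    obtain ⟨d, l', h1, h2, h3, h4, h5, h6⟩ := runsIn_fst (N := N) (q := q) hS hW hT hy hMS T 0
      { c with state := .runFst q M.start, inHead := 0, fst := fun _ _ => none,
               fstHead := fun _ => 0, ctr := fun p => l₁[p]? } l₁ (by omega)
      ⟨Nat.zero_le _, rfl, hr.ctrHead_eq, p4, ⟨fun _ => 0, by simp, by simp⟩⟩
      ⟨rfl, rfl, fun _ _ => rfl⟩ rfl (by rw [p2]; rfl) (by omega) hsn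
    rw [p1] at h3 h4
    exact ⟨d, l', ((htask.trans hclear).trans h1).mono (by unfold fetchTime; omega), h2, h3, h4,
      h5, h6⟩

theorem simStep_stepSnd {x : List α} {c : SimCfg M N} {q : N.Q} {s : InputSymbol β}
    (hc : c.inHead ≤ x.length + 1) (hs : c.state = .stepSnd q s) :
    simStep x c = (N.δ q s (fun k => c.snd k (c.sndHead k))).map fun a =>
      { c with
        state := .sweep (.move (a.inMove.clamp s) a.state) true true
        snd := fun k => Function.update (c.snd k) (c.sndHead k) (a.write k)
        sndHead := fun k => (a.move k).apply (c.sndHead k) } := by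
  simp only [simStep, simδ, SimCfg.view, hs, Option.map_map]
  congr 1
  funext a
  simp [SimCfg.act, SimView.idle, HeadMove.apply, hc]

/-- Induction on the number `m` of remaining steps of `N`. Each costs one step of its own and one
fetch; when `N` halts, so does the composed machine, with the final state of `N` recorded in
`stepSnd`. -/
theorem runsIn_snd {x : List α} {y : List β} {s W S T S' T' : ℕ} (hS : S < s) (hW : W < s)
    (hS' : S' ≤ s) (hT : M.HaltsWithin x T) (hy : (M.config x T).out = y) (hMS : M.UsesSpace x S)
    (hyW : y.length + 1 < 2 ^ W) (hT' : N.HaltsWithin y T') (hNS : N.UsesSpace y S') (m : ℕ) :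
    ∀ (t : ℕ) (c : SimCfg M N) (l : List (Bool × Bool)), t + m = T' → c.Ready x W S l →
      c.state = .stepSnd (N.config y t).state (inputAt y (N.config y t).inHead) →
      fstCounter l = (N.config y t).inHead → c.snd = (N.config y t).tape →
      c.sndHead = (N.config y t).head →
      ∃ (d : SimCfg M N) (r : InputSymbol β),
        RunsIn (simStep x) (SimCfg.Within s) (m * (1 + fetchTime x.length W S T)) c d ∧
        d.Within s ∧ d.state = .stepSnd (N.config y T').state r ∧ simStep x d = none := by
  have within (t : ℕ) (c : SimCfg M N) (l : List (Bool × Bool)) (hr : c.Ready x W S l)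
      (hh : c.sndHead = (N.config y t).head) : c.Within s :=
    ⟨by rw [hr.ctrHead_eq]; omega, hr.used.lt hS,
      fun k => by rw [hh]; exact (hNS t k).trans_le hS'⟩
  have halt (t : ℕ) (c : SimCfg M N) (l : List (Bool × Bool)) (htT : t ≤ T')
      (hr : c.Ready x W S l)
      (hst : c.state = .stepSnd (N.config y t).state (inputAt y (N.config y t).inHead))
      (hs : c.snd = (N.config y t).tape) (hh : c.sndHead = (N.config y t).head)
      (hn : N.step y (N.config y t) = none) :
      c.state = .stepSnd (N.config y T').state (inputAt y (N.config y t).inHead) ∧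
        simStep x c = none := by
    refine ⟨by rw [hst, N.config_of_halts hn htT], ?_⟩
    rw [simStep_stepSnd hr.inHead_le hst, hs, hh]
    simpa [step] using hn
  induction m with
  | zero =>
    intro t c l htm hr hst hi hs hh
    obtain rfl : t = T' := by omega
    exact ⟨c, _, .refl _ _, within t c l hr hh, halt t c l le_rfl hr hst hs hh hT'⟩
  | succ m ih =>
    intro t c l htm hr hst hi hs hh
    cases hstep : N.step y (N.config y t) with
    | none =>
      exact ⟨c, _, .refl _ _, within t c l hr hh, halt t c l (by omega) hr hst hs hh hstep⟩
    | some e' =>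
      have hcfg := N.config_succ_of_step hstep
      simp only [step, Option.map_eq_some_iff] at hstep
      obtain ⟨a, hδ, rfl⟩ := hstep
      have hstep' := simStep_stepSnd hr.inHead_le hst
      rw [hs, hh, hδ, Option.map_some] at hstep'
      obtain ⟨hcl, hcl0⟩ := HeadMove.clamp_inputAt y (N.inHead_config_le y t) a.inMove
      have hsn : ∀ k, (a.move k).apply ((N.config y t).head k) < s := fun k => by
        have := hNS (t + 1) k
        rw [hcfg] at this
        exact this.trans_le hS'
      obtain ⟨d, l', h1, h2, h3, h4, h5, h6⟩ := runsIn_fetch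
        (c := { c with
          state := .sweep (.move (a.inMove.clamp (inputAt y (N.config y t).inHead)) a.state)
            true true
          snd := fun k =>
            Function.update ((N.config y t).tape k) ((N.config y t).head k) (a.write k)
          sndHead := fun k => (a.move k).apply ((N.config y t).head k) })
        hS hW hT hy hMS ⟨hr.inHead_le, hr.ctr_eq, hr.ctrHead_eq, hr.length_le, hr.used⟩ rfl
        (by rw [hi]; exact hcl0) (by rw [hi, hcl]; omega) hsn
      rw [hi, hcl] at h3 h4
      obtain ⟨d', r, g1, g2⟩ := ih (t + 1) d l' (by omega) h2 (by rw [h3, hcfg]) (by rw [h4, hcfg])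
        (by rw [h5, hcfg]) (by rw [h6, hcfg])
      refine ⟨d', r, (((RunsIn.single (within t c l hr hh) hstep').trans h1).trans g1).mono ?_, g2⟩
      rw [Nat.succ_mul]
      omega

/-- The composed machine decides whether `N` accepts the output of `M`. -/
theorem compose_spec [Finite β] {x : List α} {y : List β} {s W S T S' T' : ℕ} (hS : S < s)
    (hW : W < s) (hS' : S' ≤ s) (hT : M.HaltsWithin x T) (hy : (M.config x T).out = y)
    (hMS : M.UsesSpace x S) (hyW : y.length + 1 < 2 ^ W) (hT' : N.HaltsWithin y T')
    (hNS : N.UsesSpace y S') {n : ℕ}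
    (hn : 1 + fetchTime x.length W S T + T' * (1 + fetchTime x.length W S T) ≤ n) :
    (compose M N).HaltsWithin x n ∧ (compose M N).UsesSpace x s ∧
      (((compose M N).config x n).state ∈ (compose M N).accept ↔
        (N.config y T').state ∈ N.accept) := by
  obtain ⟨d, l, h1, h2, h3, h4, h5, h6⟩ := runsIn_fetch (N := N) (c := simInit M N) (l := [])
    hS hW hT hy hMS
    ⟨Nat.zero_le _, by simp [simInit], rfl, Nat.zero_le _, ⟨fun _ => 0, by simp [simInit],
      by simp [simInit]⟩⟩ rfl (by simp) (by simp [HeadMove.apply])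
    (fun k => (Nat.zero_le _).trans_lt ((hNS 0 k).trans_le hS'))
  obtain ⟨d', r, g1, g2, g3, g4⟩ := runsIn_snd hS hW hS' hT hy hMS hyW hT' hNS T' 0 d l (by omega)
    h2 h3 h4 h5 h6
  have hsafe : ∀ c : SimCfg M N, c.Within s → ∀ k, c.toCfg.head k < s := by
    rintro c ⟨w1, w2, w3⟩ (_ | k | k)
    exacts [w1, w2 k, w3 k]
  have hrun := (h1.trans g1).map (g := (compose M N).step x)
    (safe' := fun c => ∀ k, c.head k < s) SimCfg.toCfg
    (fun c e hce => by rw [compose_step_toCfg, hce]; rfl) hsafe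
  have hrun' := (RunsIn.single (safe := fun c : (compose M N).Cfg => ∀ k, c.head k < s)
    (fun k => (Nat.zero_le _).trans_lt hS) (compose_step_init M N x)).trans hrun
  obtain ⟨r1, r2, r3⟩ := (compose M N).halts_of_runsIn (n := n) (hrun'.mono (by omega))
    (by rw [compose_step_toCfg, g4]; rfl) (hsafe d' g2)
  refine ⟨r1, r2, ?_⟩
  rw [r3]
  change some d'.state ∈ {st | ∃ q ∈ N.accept, ∃ s, st = some (SimState.stepSnd q s)} ↔ _
  simp [g3]

end OfflineTM

/-! ### Time from space: counting configurations -/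

namespace OfflineTM

variable {α β : Type} (M : OfflineTM α β)

/-- The configurations agree, except possibly for the output. -/
def Cfg.SameCore {M : OfflineTM α β} (c d : M.Cfg) : Prop :=
  c.state = d.state ∧ c.inHead = d.inHead ∧ c.tape = d.tape ∧ c.head = d.head

variable {M} in
theorem Cfg.SameCore.step_eq_none {x : List α} {c d : M.Cfg} (h : c.SameCore d)
    (hd : M.step x d = none) : M.step x c = none := by
  obtain ⟨h1, h2, h3, h4⟩ := h
  simpa [OfflineTM.step, h1, h2, h3, h4] using hd

/-- The transition function never reads the output tape, so the growing output can be left out of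
the configuration count. -/
theorem sameCore_config_succ {x : List α} {t u : ℕ}
    (h : (M.config x t).SameCore (M.config x u)) :
    (M.config x (t + 1)).SameCore (M.config x (u + 1)) := by
  simp only [config]
  generalize M.config x t = c at *
  generalize M.config x u = d at *
  obtain ⟨cs, ci, ct, ch, co⟩ := c
  obtain ⟨ds, di, dt, dh, dout⟩ := d
  obtain ⟨h1, h2, h3, h4⟩ := h
  simp only at h1 h2 h3 h4
  subst h1 h2 h3 h4
  simp only [step]
  cases M.δ cs (inputAt x ci) (fun k => ct k (ch k)) <;> exact ⟨rfl, rfl, rfl, rfl⟩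

theorem sameCore_config_add {x : List α} {t u : ℕ}
    (h : (M.config x t).SameCore (M.config x u)) (j : ℕ) :
    (M.config x (t + j)).SameCore (M.config x (u + j)) := by
  induction j with
  | zero => exact h
  | succ j ih => exact M.sameCore_config_succ ih

theorem tape_eq_blank {x : List α} {S : ℕ} (hS : M.UsesSpace x S) (t : ℕ) (k : M.K) {p : ℕ}
    (hp : S ≤ p) : (M.config x t).tape k p = M.blank := by
  induction t with
  | zero => rfl
  | succ t ih =>
    rw [config]
    cases h : M.step x (M.config x t) with
    | none => simpa using ih
    | some c =>
      simp only [step, Option.map_eq_some_iff] at h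
      obtain ⟨a, _, rfl⟩ := h
      have := hS t k
      simp only [Option.getD_some]
      rw [Function.update_of_ne (by omega), ih]

/-- A machine that halts in space `S` halts before a configuration is repeated. -/
theorem haltsWithin_of_usesSpace {x : List α} {S t : ℕ} (hS : M.UsesSpace x S)
    (ht : M.HaltsWithin x t) :
    M.HaltsWithin x (Nat.card M.Q * (x.length + 2) *
      2 ^ ((Nat.card M.Γ * Nat.card M.K + Nat.card M.K) * S)) := by
  classical
  have hex : ∃ t, M.HaltsWithin x t := ⟨t, ht⟩
  have hfind := Nat.find_spec hex
  refine HaltsWithin.mono hfind ?_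
  set T := Nat.find hex
  let f : Fin T → M.Q × Fin (x.length + 2) × (M.K → Fin S → M.Γ) × (M.K → Fin S) := fun i =>
    ((M.config x i).state,
      ⟨(M.config x i).inHead, by have := M.inHead_config_le x i; omega⟩,
      fun k p => (M.config x i).tape k p, fun k => ⟨(M.config x i).head k, hS i k⟩)
  have key (i j : Fin T) (hij : i < j) : f i ≠ f j := by
    intro h
    simp only [f, Prod.mk.injEq, Fin.mk.injEq] at h
    obtain ⟨h1, h2, h3, h4⟩ := h
    have hcore : (M.config x i).SameCore (M.config x j) := by
      refine ⟨h1, h2, ?_, ?_⟩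
      · funext k p
        by_cases hp : p < S
        · exact congrFun (congrFun h3 k) ⟨p, hp⟩
        · rw [M.tape_eq_blank hS _ _ (by omega), M.tape_eq_blank hS _ _ (by omega)]
      · funext k
        simpa using congrFun h4 k
    have hlt : (i : ℕ) < j := hij
    have hj := j.2
    -- If the configurations at times `i < j` agreed, the remaining `T - j` steps could be made from
    -- time `i`, and the machine would halt before its least halting time `T`.
    have := M.sameCore_config_add hcore (T - j)
    rw [show (j : ℕ) + (T - j) = T by omega] at this
    exact Nat.find_min hex (m := i + (T - j)) (by omega) (this.step_eq_none hfind)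
  have hf : Function.Injective f := by
    intro i j h
    rcases lt_trichotomy i j with hij | hij | hij
    · exact absurd h (key i j hij)
    · exact hij
    · exact absurd h.symm (key j i hij)
  have hcard := Nat.card_le_card_of_injective f hf
  simp only [Nat.card_prod, Nat.card_fun, Nat.card_fin] at hcard
  refine hcard.trans ?_
  -- The crude bounds `a ≤ 2 ^ a` for the work alphabet size and for `S` bring the count into the
  -- form `2 ^ (D * S)`.
  rw [mul_assoc, add_mul (Nat.card M.Γ * Nat.card M.K), pow_add]
  refine Nat.mul_le_mul_left _ (Nat.mul_le_mul_left _ (Nat.mul_le_mul ?_ ?_))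
  · calc (Nat.card M.Γ ^ S) ^ Nat.card M.K
        ≤ ((2 ^ Nat.card M.Γ) ^ S) ^ Nat.card M.K := by
          gcongr
          exact Nat.lt_two_pow_self.le
      _ = 2 ^ (Nat.card M.Γ * Nat.card M.K * S) := by
          rw [← pow_mul, ← pow_mul]; congr 1; ring
  · calc S ^ Nat.card M.K ≤ (2 ^ S) ^ Nat.card M.K := by
          gcongr
          exact Nat.lt_two_pow_self.le
      _ = 2 ^ (Nat.card M.K * S) := by rw [← pow_mul, mul_comm]

end OfflineTM

/-! ### Asymptotics -/

section Asymptotics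

open Asymptotics Filter

/-- The function is bounded by a polynomial. -/
def PolyBounded (f : ℕ → ℕ) : Prop :=
  ∃ k : ℕ, (fun n => (f n : ℝ)) =O[atTop] (fun n : ℕ => (n : ℝ) ^ k)

theorem isBigO_one_rpow {ε : ℝ} (hε : 0 ≤ ε) :
    (fun _ : ℕ => (1 : ℝ)) =O[atTop] (fun n : ℕ => (n : ℝ) ^ ε) := by
  refine IsBigO.of_bound 1 ?_
  filter_upwards [eventually_ge_atTop 1] with n hn
  have h1 : (1 : ℝ) ≤ n := by exact_mod_cast hn
  have := Real.one_le_rpow h1 hε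
  rw [Real.norm_of_nonneg zero_le_one, Real.norm_of_nonneg (by linarith)]
  linarith

theorem isBigO_pow_pow {a b : ℕ} (hab : a ≤ b) :
    (fun n : ℕ => (n : ℝ) ^ a) =O[atTop] (fun n : ℕ => (n : ℝ) ^ b) := by
  refine IsBigO.of_bound 1 ?_
  filter_upwards [eventually_ge_atTop 1] with n hn
  have h1 : (1 : ℝ) ≤ n := by exact_mod_cast hn
  rw [Real.norm_of_nonneg (by positivity), Real.norm_of_nonneg (by positivity), one_mul]
  exact pow_le_pow_right₀ h1 hab

namespace PolyBounded

variable {f g : ℕ → ℕ}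

theorem of_isBigO_rpow {ε : ℝ}
    (h : (fun n => (f n : ℝ)) =O[atTop] (fun n : ℕ => (n : ℝ) ^ ε)) : PolyBounded f := by
  refine ⟨⌈ε⌉₊, h.trans (IsBigO.of_bound 1 ?_)⟩
  filter_upwards [eventually_ge_atTop 1] with n hn
  have h1 : (1 : ℝ) ≤ n := by exact_mod_cast hn
  rw [Real.norm_of_nonneg (by positivity), Real.norm_of_nonneg (by positivity), one_mul,
    ← Real.rpow_natCast]
  exact Real.rpow_le_rpow_of_exponent_le h1 (Nat.le_ceil ε)

theorem const (a : ℕ) : PolyBounded fun _ => a :=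
  ⟨0, by simpa using isBigO_const_const (a : ℝ) (one_ne_zero (α := ℝ)) atTop⟩

protected theorem id : PolyBounded fun n => n :=
  ⟨1, by simpa using isBigO_refl _ _⟩

theorem add (hf : PolyBounded f) (hg : PolyBounded g) : PolyBounded fun n => f n + g n := by
  obtain ⟨a, ha⟩ := hf
  obtain ⟨b, hb⟩ := hg
  refine ⟨max a b, ?_⟩
  simpa using (ha.trans (isBigO_pow_pow (le_max_left a b))).add
    (hb.trans (isBigO_pow_pow (le_max_right a b)))

theorem mul (hf : PolyBounded f) (hg : PolyBounded g) : PolyBounded fun n => f n * g n := by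
  obtain ⟨a, ha⟩ := hf
  obtain ⟨b, hb⟩ := hg
  refine ⟨a + b, ?_⟩
  simpa [pow_add] using ha.mul hb

theorem pow (hf : PolyBounded f) (k : ℕ) : PolyBounded fun n => f n ^ k := by
  induction k with
  | zero => simpa using const 1
  | succ k ih => simpa [pow_succ] using ih.mul hf

theorem two_pow {S : ℕ → ℕ}
    (hS : (fun n => (S n : ℝ)) =O[atTop] (fun n : ℕ => Real.logb 2 n)) (D : ℕ) :
    PolyBounded fun n => 2 ^ (D * S n) := by
  obtain ⟨C, hC⟩ := hS.bound
  refine of_isBigO_rpow (ε := D * C) (IsBigO.of_bound 1 ?_)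
  filter_upwards [hC, eventually_ge_atTop 1] with n hn hn1
  have h1 : (1 : ℝ) ≤ n := by exact_mod_cast hn1
  rw [Real.norm_of_nonneg (by positivity),
    Real.norm_of_nonneg (Real.logb_nonneg (by norm_num) h1)] at hn
  rw [Real.norm_of_nonneg (by positivity), Real.norm_of_nonneg (by positivity), one_mul]
  push_cast
  calc (2 : ℝ) ^ (D * S n) = (2 : ℝ) ^ ((D : ℝ) * (S n : ℝ)) := by
        rw [← Nat.cast_mul, Real.rpow_natCast]
    _ ≤ (2 : ℝ) ^ (Real.logb 2 n * (D * C)) := by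
        refine Real.rpow_le_rpow_of_exponent_le (by norm_num) ?_
        calc (D : ℝ) * S n ≤ D * (C * Real.logb 2 n) := by gcongr
          _ = Real.logb 2 n * (D * C) := by ring
    _ = (n : ℝ) ^ ((D : ℝ) * C) := by
        rw [Real.rpow_mul (by norm_num), Real.rpow_logb (by norm_num) (by norm_num) (by linarith)]

end PolyBounded

theorem isBigO_logb_rpow {ε : ℝ} (hε : 0 < ε) :
    (fun n : ℕ => Real.logb 2 n) =O[atTop] (fun n : ℕ => (n : ℝ) ^ ε) := by
  have h := ((isLittleO_log_rpow_atTop hε).comp_tendsto tendsto_natCast_atTop_atTop).isBigO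
  simpa [Function.comp_def, Real.logb, div_eq_inv_mul] using h.const_mul_left (Real.log 2)⁻¹

theorem isBigO_natLog_logb :
    (fun n : ℕ => (Nat.log 2 (n + 2) : ℝ)) =O[atTop] (fun n : ℕ => Real.logb 2 n) := by
  refine IsBigO.of_bound 2 ?_
  filter_upwards [eventually_ge_atTop 2] with n hn
  have h1 : (2 : ℝ) ≤ n := by exact_mod_cast hn
  rw [Real.norm_of_nonneg (by positivity),
    Real.norm_of_nonneg (Real.logb_nonneg (by norm_num) (by linarith))]
  calc (Nat.log 2 (n + 2) : ℝ) ≤ Real.logb 2 ((n + 2 : ℕ) : ℝ) := by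
        exact_mod_cast Real.natLog_le_logb (n + 2) 2
    _ ≤ Real.logb 2 ((n : ℝ) ^ 2) := by
        refine Real.logb_le_logb_of_le (by norm_num) (by positivity) ?_
        push_cast
        nlinarith
    _ = 2 * Real.logb 2 n := by rw [Real.logb_pow]; norm_num

/-- The bounds for `N` are evaluated at the length of `f x`, which may stay small while `x` grows;
an eventual bound is not enough there. The finitely many exceptional values are absorbed into the
constant. -/
theorem exists_forall_le_of_isBigO {f : ℕ → ℕ} {g : ℕ → ℝ} (hg : ∀ n, 0 ≤ g n)
    (h : (fun n => (f n : ℝ)) =O[atTop] g) : ∃ C : ℕ, ∀ n, (f n : ℝ) ≤ C * (g n + 1) := by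
  obtain ⟨C, hC⟩ := h.bound
  obtain ⟨n₀, hn₀⟩ := eventually_atTop.1 hC
  refine ⟨⌈C⌉₊ + ∑ i ∈ Finset.range n₀, f i, fun n => ?_⟩
  have hgn := hg n
  push_cast
  have hsum : (0 : ℝ) ≤ ∑ i ∈ Finset.range n₀, (f i : ℝ) :=
    Finset.sum_nonneg fun _ _ => Nat.cast_nonneg _
  rcases lt_or_ge n n₀ with hn | hn
  · have h1 : (f n : ℝ) ≤ ∑ i ∈ Finset.range n₀, (f i : ℝ) :=
      Finset.single_le_sum (f := fun i => (f i : ℝ)) (fun _ _ => Nat.cast_nonneg _)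
        (Finset.mem_range.2 hn)
    have h2 : (0 : ℝ) ≤ (⌈C⌉₊ : ℝ) := Nat.cast_nonneg _
    nlinarith [mul_nonneg hsum hgn, mul_nonneg h2 hgn]
  · have h1 := hn₀ n hn
    rw [Real.norm_of_nonneg (Nat.cast_nonneg _), Real.norm_of_nonneg hgn] at h1
    have h2 : C * g n ≤ ⌈C⌉₊ * g n := mul_le_mul_of_nonneg_right (Nat.le_ceil C) hgn
    have h3 : (0 : ℝ) ≤ (⌈C⌉₊ : ℝ) := Nat.cast_nonneg _
    nlinarith [mul_nonneg hsum hgn]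

theorem isBigO_natFloor {f : ℕ → ℝ} (hf : ∀ n, 0 ≤ f n) :
    (fun n => (⌊f n⌋₊ : ℝ)) =O[atTop] f :=
  IsBigO.of_bound 1 (Eventually.of_forall fun n => by
    rw [Real.norm_of_nonneg (Nat.cast_nonneg _), Real.norm_of_nonneg (hf n), one_mul]
    exact Nat.floor_le (hf n))

end Asymptotics

/-! ### Choice of the bounds -/

open Asymptotics Filter in
theorem theorem2 {α β : Type} [Finite α] [Finite β] (A : Language α) (B : Language β)
    (hAB : LogSpaceReducible A B) (hB : B ∈ NearSC β) : A ∈ NearSC α := by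
  obtain ⟨f, ⟨M, S, hS, hM⟩, hf⟩ := hAB
  simp only [NearSC, Set.mem_iInter, NearSCEps, Set.mem_iUnion] at hB ⊢
  intro ε hε
  set D := Nat.card M.Γ * Nat.card M.K + Nat.card M.K
  let T : ℕ → ℕ := fun n => Nat.card M.Q * (n + 2) * 2 ^ (D * S n)
  have hTpoly : PolyBounded T :=
    ((PolyBounded.const _).mul (PolyBounded.id.add (.const 2))).mul (.two_pow hS D)
  obtain ⟨c, hc⟩ := hTpoly
  have hc1 : (0 : ℝ) < c + 1 := by positivity
  -- Since `T n = O(n ^ c)`, this exponent leads back to `n ^ ε`; `c + 1` instead of `c` avoids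
  -- division by zero.
  obtain ⟨k, N, T', S', hT', hS', hN⟩ := hB (ε / (c + 1)) (by positivity)
  obtain ⟨CT, hCT⟩ := exists_forall_le_of_isBigO (fun n => by positivity) hT'
  obtain ⟨CS, hCS⟩ := exists_forall_le_of_isBigO (fun n => by positivity) hS'
  -- The first three summands bound the three factors of `T n` by powers of two; the final `1` makes
  -- room for the right end marker position.
  let W : ℕ → ℕ := fun n => Nat.card M.Q + (Nat.log 2 (n + 2) + 1) + D * S n + 1
  -- `T'` and `S'` need not be monotone, so `U` and `V` evaluate their monotone majorants at `T n`,
  -- which bounds the length of `f x`.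
  let U : ℕ → ℕ := fun n => CT * (T n ^ k + 1)
  let V : ℕ → ℕ := fun n => ⌊(CS : ℝ) * ((T n : ℝ) ^ (ε / (c + 1)) + 1)⌋₊
  let F : ℕ → ℕ := fun n => OfflineTM.fetchTime n (W n) (S n) (T n)
  have hSε := hS.trans (isBigO_logb_rpow hε)
  have hone := isBigO_one_rpow hε.le
  have hconst (a : ℝ) : (fun _ : ℕ => a) =O[atTop] (fun n : ℕ => (n : ℝ) ^ ε) := by
    simpa using hone.const_mul_left a
  have hWε : (fun n => (W n : ℝ)) =O[atTop] (fun n : ℕ => (n : ℝ) ^ ε) := by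
    simpa [W] using (((hconst (Nat.card M.Q)).add
      ((isBigO_natLog_logb.trans (isBigO_logb_rpow hε)).add hone)).add
      (hSε.const_mul_left (D : ℝ))).add hone
  have hVε : (fun n => (V n : ℝ)) =O[atTop] (fun n : ℕ => (n : ℝ) ^ ε) := by
    refine (isBigO_natFloor fun n => by positivity).trans
      (IsBigO.const_mul_left (IsBigO.add ?_ hone) _)
    have h1 := (hc.trans (isBigO_pow_pow (Nat.le_succ c))).rpow (r := ε / (c + 1)) (by positivity)
      (Eventually.of_forall fun n => by positivity)
    refine h1.congr_right fun n => ?_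
    rw [← Real.rpow_natCast, ← Real.rpow_mul (Nat.cast_nonneg n)]
    congr 1
    push_cast
    field_simp
  have hTp : PolyBounded T := ⟨c, hc⟩
  have hSp : PolyBounded S := .of_isBigO_rpow hSε
  have hWp : PolyBounded W := .of_isBigO_rpow hWε
  have hUp : PolyBounded U := (PolyBounded.const CT).mul ((hTp.pow k).add (.const 1))
  have h2W : PolyBounded fun n => 2 * W n := (PolyBounded.const 2).mul hWp
  have hFp : PolyBounded F :=
    ((h2W.add (.const 2)).add ((((PolyBounded.const 2).mul hSp).add .id).add (.const 3))).add
      ((hTp.mul (h2W.add (.const 3))).add (.const 1))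
  obtain ⟨K, hK⟩ := ((PolyBounded.const 1).add hFp).add (hUp.mul ((PolyBounded.const 1).add hFp))
  refine ⟨K, OfflineTM.compose M N, fun n => 1 + F n + U n * (1 + F n),
    fun n => S n + W n + V n + 1, hK, ?_, fun x => ?_⟩
  · simpa using ((hSε.add hWε).add hVε).add hone
  obtain ⟨hMS, t, ht, hout⟩ := hM x
  have hMT : M.HaltsWithin x (T x.length) := M.haltsWithin_of_usesSpace hMS ht
  have hMout : (M.config x (T x.length)).out = f x := by
    rw [← hout]
    rcases le_total t (T x.length) with h | h
    · rw [M.config_of_halts ht h]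
    · rw [M.config_of_halts hMT h]
  have hlen : (f x).length ≤ T x.length := hMout ▸ M.length_out_le x _
  have hTW : T x.length + 1 < 2 ^ W x.length := by
    have h1 : T x.length <
        2 ^ Nat.card M.Q * 2 ^ (Nat.log 2 (x.length + 2) + 1) * 2 ^ (D * S x.length) :=
      Nat.mul_lt_mul_of_pos_right (Nat.mul_lt_mul'' Nat.lt_two_pow_self
        (Nat.lt_pow_succ_log_self (by norm_num) _)) (by positivity)
    simp only [W, pow_add, pow_one] at h1 ⊢
    omega
  obtain ⟨hNT, hNS, hNB⟩ := hN (f x)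
  have hT'U : T' (f x).length ≤ U x.length := by
    have h1 : T' (f x).length ≤ CT * ((f x).length ^ k + 1) := by
      exact_mod_cast hCT (f x).length
    refine h1.trans ?_
    simp only [U]
    gcongr
  have hS'V : S' (f x).length ≤ V x.length := by
    refine Nat.le_floor ((hCS _).trans ?_)
    gcongr
  obtain ⟨h1, h2, h3⟩ := OfflineTM.compose_spec (s := S x.length + W x.length + V x.length + 1)
    (n := 1 + F x.length + U x.length * (1 + F x.length)) (S := S x.length) (W := W x.length)
    (by omega) (by omega) (by omega) hMT hMout hMS (by omega) hNT hNS
    (Nat.add_le_add_left (Nat.mul_le_mul_right _ hT'U) _)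
  exact ⟨h1, h2, by rw [h3, hNB, hf]⟩
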